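/- Let $k,N$ be integers with $1<k<N$, let $s\in(\tfrac12,1)$ and let $p\in\mathbb R$. For an orthonormal set $\xi=\{\xi_1,\dots,\xi_k\}\subset\mathbb R^N$ put $\xi\tau:=\sum_{i=1}^k\tau_i\xi_i$ for $\tau\in\mathbb R^k$, and let $$\mathcal J_k^+u(x)=\sup_{\xi}\;C_{k,s}\,\mathrm{P.V.}\!\int_{\mathbb R^k}\bigl[u(x+\xi\tau)-u(x)\bigr]\,|\tau|^{-(k+2s)}\,d\tau ,$$ the supremum being over all orthonormal sets of $k$ vectors in $\mathbb R^N$, where $C_{k,s}=\dfrac{4^s\,s\,\Gamma(\frac k2+s)}{\pi^{k/2}\,\Gamma(1-s)}$ is the normalizing constant of the fractional Laplacian in $\mathbb R^k$. A nonnegative lower semicontinuous function $u:\mathbb R^N\to[0,\infty)$ is called a viscosity supersolution of $\mathcal J_k^+u+u^p=0$ in $\mathbb R^N$ if for every $x_0\in\mathbb R^N$, every $\delta>0$ and every $\varphi\in C^2(B_\delta(x_0))$ such that $u-\varphi$ attains its minimum over $B_\delta(x_0)$ at $x_0$, one has $$\sup_{\xi}\Bigl\{C_{k,s}\,\mathrm{P.V.}\!\int_{|\tau|<\delta}\frac{\varphi(x_0+\xi\tau)-\varphi(x_0)}{|\tau|^{k+2s}}\,d\tau+C_{k,s}\int_{|\tau|\ge\delta}\frac{u(x_0+\xi\tau)-u(x_0)}{|\tau|^{k+2s}}\,d\tau\Bigr\}+u(x_0)^p\le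 0 .$$ Here the integrals are taken with values in $[-\infty,+\infty]$ (with $\infty-\infty:=-\infty$), and the principal value is understood in the symmetrized form $\frac12\int_{|\tau|<\delta}[\varphi(x_0+\xi\tau)+\varphi(x_0-\xi\tau)-2\varphi(x_0)]\,|\tau|^{-(k+2s)}\,d\tau$; for $p\le 0$ we set $0^0=1$ and $0^p=0$ if $p<0$. **Theorem.** The equation $\mathcal J_k^+u+u^p=0$ in $\mathbb R^N$ has a nonnegative viscosity supersolution $u\not\equiv0$ if and only if $$p>\frac{k}{k-2s}.$$ -/

import Mathlib

open MeasureTheory Set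
open scoped ENNReal

noncomputable section

namespace TruncFracLap

/-- The integral of a real function, with values in `[-∞, +∞]`: the integral of the positive part
minus the integral of the negative part.  (It is used where at most one of the two is infinite;
in `EReal`, `⊤ - ⊤ = ⊥`.) -/
def extIntegral {α : Type*} [MeasurableSpace α] (μ : Measure α) (f : α → ℝ) : EReal :=
  ((∫⁻ a, ENNReal.ofReal (f a) ∂μ : ℝ≥0∞) : EReal) -
    ((∫⁻ a, ENNReal.ofReal (-f a) ∂μ : ℝ≥0∞) : EReal)

/-- The normalizing constant of the fractional Laplacian of order `2s` in `ℝ^k`,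
`C_{k,s} = 4^s s Γ(k/2 + s) / (π^{k/2} Γ(1 - s))`. -/
def normConst (k : ℕ) (s : ℝ) : ℝ :=
  (4 : ℝ) ^ s * s * Real.Gamma (k / 2 + s) / (Real.pi ^ ((k : ℝ) / 2) * Real.Gamma (1 - s))

/-- The kernel `C_{k,s} |τ|^{-(k+2s)}` on `ℝ^k`. -/
def kernel (k : ℕ) (s : ℝ) (τ : EuclideanSpace ℝ (Fin k)) : ℝ :=
  normConst k s * ‖τ‖ ^ (-((k : ℝ) + 2 * s))

/-- The point `∑ τ_i ξ_i` of the span of the frame `ξ`. -/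
def framePoint {N k : ℕ} (ξ : Fin k → EuclideanSpace ℝ (Fin N)) (τ : EuclideanSpace ℝ (Fin k)) :
    EuclideanSpace ℝ (Fin N) :=
  ∑ i, τ i • ξ i

/-- The part of `𝒥_V φ(x)` inside the ball of radius `δ`, `V` being spanned by the frame `ξ`:
`C_{k,s} P.V. ∫_{|τ| < δ} [φ(x + ∑ τ_i ξ_i) - φ(x)] |τ|^{-(k+2s)} dτ`.
As the kernel is even, the principal value is written in its symmetrized form
`(C_{k,s} / 2) ∫_{|τ| < δ} [φ(x + ∑ τ_i ξ_i) + φ(x - ∑ τ_i ξ_i) - 2 φ(x)] |τ|^{-(k+2s)} dτ`. -/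
def innerPart {N k : ℕ} (s : ℝ) (ξ : Fin k → EuclideanSpace ℝ (Fin N))
    (φ : EuclideanSpace ℝ (Fin N) → ℝ) (x : EuclideanSpace ℝ (Fin N)) (δ : ℝ) : EReal :=
  extIntegral (volume.restrict {τ : EuclideanSpace ℝ (Fin k) | ‖τ‖ < δ}) fun τ =>
    (φ (x + framePoint ξ τ) + φ (x - framePoint ξ τ) - 2 * φ x) / 2 * kernel k s τ

/-- The part of `𝒥_V u(x)` outside the ball of radius `δ`, `V` being spanned by the frame `ξ`:
`C_{k,s} ∫_{|τ| ≥ δ} [u(x + ∑ τ_i ξ_i) - u(x)] |τ|^{-(k+2s)} dτ`. -/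
def outerPart {N k : ℕ} (s : ℝ) (ξ : Fin k → EuclideanSpace ℝ (Fin N))
    (u : EuclideanSpace ℝ (Fin N) → ℝ) (x : EuclideanSpace ℝ (Fin N)) (δ : ℝ) : EReal :=
  extIntegral (volume.restrict {τ : EuclideanSpace ℝ (Fin k) | δ ≤ ‖τ‖}) fun τ =>
    (u (x + framePoint ξ τ) - u x) * kernel k s τ

/-- The evaluation `𝒥_k^+(u, φ, x, δ)` of the maximal operator, with the test function `φ` inside
the ball of radius `δ` and `u` outside: the supremum over all orthonormal `k`-frames. -/
def maxOp {N : ℕ} (k : ℕ) (s : ℝ) (u φ : EuclideanSpace ℝ (Fin N) → ℝ)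
    (x : EuclideanSpace ℝ (Fin N)) (δ : ℝ) : EReal :=
  ⨆ ξ : {ξ : Fin k → EuclideanSpace ℝ (Fin N) // Orthonormal ℝ ξ},
    (innerPart s ξ.1 φ x δ + outerPart s ξ.1 u x δ)

/-- `u` is a viscosity supersolution of `𝒥_k^+ u + u^p = 0` in `ℝ^N`. -/
def IsViscositySupersolution {N : ℕ} (k : ℕ) (s p : ℝ)
    (u : EuclideanSpace ℝ (Fin N) → ℝ) : Prop :=
  LowerSemicontinuous u ∧
    ∀ (x : EuclideanSpace ℝ (Fin N)) (δ : ℝ) (φ : EuclideanSpace ℝ (Fin N) → ℝ),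
      0 < δ → ContDiffOn ℝ 2 φ (Metric.ball x δ) →
      IsMinOn (fun y => u y - φ y) (Metric.ball x δ) x →
        maxOp k s u φ x δ + ((u x ^ p : ℝ) : EReal) ≤ 0

end TruncFracLap

end

/-!
Write `β = k - 2s` and `r = |y|`.  Everything rests on one computation on `ℝ^k`: the inversion in
the sphere through a point `e ≠ 0` carries the principal value integral of a radial function `f(r)`
over the ball `|y| < |e|` to an integral over its complement, and the kernel is conformally
covariant.  This gives (`symIntegral_radial`), up to the normalizing constant and with `ρ = |e|`,
`-(-Δ)^s f (e) = ∫_{|y| > ρ} [f(r) - f(ρ) + (f(ρ²/r) - f(ρ)) (r/ρ)^{-β}] |y - e|^{-k-2s} dy`,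
an absolutely convergent integral whose sign can be read off.  For `f = r^{-β}` the bracket vanishes
identically: this is the fundamental solution.

*Nonexistence for `p ≤ k/β`.*  A supersolution that is not identically zero is positive.  If a
bounded radial function touches it from below at `x`, then a frame whose span contains `x` turns the
inequality into one for the same radial function on `ℝ^k`.  Touching with `r^{-β}`, capped by a
large constant in the unit ball so as to be subharmonic far out, gives `u ≥ c |x|^{-β}`
(`exists_power_le`).  As `u` takes bounded values at the contact points, `u^p ≥ c u^{k/β}` there,
hence `u^p ≥ c |x|^{-k}`, which is the size of the defect of the barrier `r^{-β} log r`; so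
`u ≥ c |x|^{-β} log |x|` (`exists_logPower_le`).  On the other hand, touching with a paraboloid of
width `R` bounds the power `(min_{B_{2R}} u)^{k/β}` by `C R^{-2s} min_{B_R} u`, which keeps
`R^β min_{B_R} u` bounded along dyadic radii (`exists_rescaled_min_le`).  The two bounds contradict
each other.

*Existence for `p > k/β`.*  The supersolution is `ε (1 + |x|²)^{-γ/2}` with `γ = 2s/(p-1) < β`.  On
an affine `k`-plane it is radial with profile `(b + r²)^{-γ/2}`, where `b ≥ 1` depends on the plane.
By convexity the inward increment `f(ρ²/r) - f(ρ)` is at most `(r/ρ)^γ` times the outward decrement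
`f(ρ) - f(r)`, so the bracket above is nonpositive as `γ < β`, and it is comparable with `-f(ρ)`
for `r ≥ 2 (b + ρ²)^{1/2}`.  This yields the bound `-c (1 + |x|²)^{-(γ+2s)/2}`, uniformly over all
planes.
-/

noncomputable section

namespace TruncFracLap

open Filter Topology
open scoped Pointwise

/-! ### Radial kernels -/

/-- The homogeneous kernel `|τ|^{-(k+a)}` on `ℝ^k`; for `a = 2s` it is the kernel of the fractional
Laplacian without its normalizing constant.  Its value at `τ = 0` is `0` as soon as `k + a ≠ 0`. -/
def powKernel {k : ℕ} (a : ℝ) (τ : EuclideanSpace ℝ (Fin k)) : ℝ := ‖τ‖ ^ (-((k : ℝ) + a))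

/-- The weight `min (t², t^s)`: against `|τ|^{-(k+2s)}` it is integrable both at the origin and at
infinity. -/
def cutWeight (s t : ℝ) : ℝ := min (t ^ 2) (t ^ s)

section Kernel

variable {k : ℕ} {s a : ℝ}

lemma nontrivial_euclideanSpace (hk : 1 ≤ k) : Nontrivial (EuclideanSpace ℝ (Fin k)) :=
  Module.nontrivial_of_finrank_pos (R := ℝ) (by rw [finrank_euclideanSpace_fin]; omega)

lemma kernel_eq (k : ℕ) (s : ℝ) (τ : EuclideanSpace ℝ (Fin k)) :
    kernel k s τ = normConst k s * powKernel (2 * s) τ := rfl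

lemma normConst_pos (k : ℕ) (hs : 0 < s) (hs1 : s < 1) : 0 < normConst k s := by
  have h1 : 0 < Real.Gamma ((k : ℝ) / 2 + s) := Real.Gamma_pos_of_pos (by positivity)
  have h2 : 0 < Real.Gamma (1 - s) := Real.Gamma_pos_of_pos (by linarith)
  have := Real.pi_pos
  unfold normConst
  positivity

lemma powKernel_nonneg (a : ℝ) (τ : EuclideanSpace ℝ (Fin k)) : 0 ≤ powKernel a τ :=
  Real.rpow_nonneg (norm_nonneg _) _

lemma powKernel_neg (a : ℝ) (τ : EuclideanSpace ℝ (Fin k)) : powKernel a (-τ) = powKernel a τ := by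
  simp [powKernel]

lemma measurable_powKernel (a : ℝ) :
    Measurable (powKernel a : EuclideanSpace ℝ (Fin k) → ℝ) := by
  unfold powKernel; fun_prop

lemma powKernel_smul (a : ℝ) {R : ℝ} (hR : 0 < R) (τ : EuclideanSpace ℝ (Fin k)) :
    powKernel a (R • τ) = R ^ (-((k : ℝ) + a)) * powKernel a τ := by
  unfold powKernel
  rw [norm_smul, Real.norm_of_nonneg hR.le, Real.mul_rpow hR.le (norm_nonneg _)]

lemma cutWeight_nonneg {t : ℝ} (ht : 0 ≤ t) : 0 ≤ cutWeight s t :=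
  le_min (by positivity) (Real.rpow_nonneg ht _)

lemma cutWeight_of_le_one (hs : s ≤ 2) {t : ℝ} (ht : 0 ≤ t) (ht1 : t ≤ 1) (hs0 : s ≠ 0) :
    cutWeight s t = t ^ 2 := by
  refine min_eq_left ?_
  rcases ht.eq_or_lt with rfl | h
  · simp [Real.zero_rpow hs0]
  · rw [← Real.rpow_natCast]
    exact Real.rpow_le_rpow_of_exponent_ge h ht1 (by exact_mod_cast hs)

lemma cutWeight_of_one_le (hs : s ≤ 2) {t : ℝ} (ht : 1 ≤ t) : cutWeight s t = t ^ s := by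
  refine min_eq_right ?_
  rw [← Real.rpow_natCast]
  exact Real.rpow_le_rpow_of_exponent_le ht (by exact_mod_cast hs)

lemma one_le_cutWeight (hs : 0 ≤ s) {t : ℝ} (ht : 1 ≤ t) : 1 ≤ cutWeight s t :=
  le_min (one_le_pow₀ ht) (Real.one_le_rpow ht hs)

lemma pow_mul_rpow_eq (hk : 1 ≤ k) (b : ℝ) {y : ℝ} (hy : 0 < y) :
    y ^ (k - 1) * y ^ b = y ^ ((k : ℝ) - 1 + b) := by
  rw [← Real.rpow_natCast y (k - 1), ← Real.rpow_add hy, Nat.cast_sub hk, Nat.cast_one]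

/-- The weight `cutWeight` makes the kernel of the fractional Laplacian integrable. -/
lemma integrable_cutWeight_one (hk : 1 ≤ k) (hs : 1 / 2 < s) (hs1 : s < 1) :
    Integrable fun τ : EuclideanSpace ℝ (Fin k) => cutWeight s ‖τ‖ * powKernel (2 * s) τ := by
  have := nontrivial_euclideanSpace hk
  unfold powKernel
  rw [integrable_fun_norm_addHaar volume
    (f := fun y : ℝ => cutWeight s y * y ^ (-((k : ℝ) + 2 * s)))]
  rw [← Ioc_union_Ioi_eq_Ioi (zero_le_one (α := ℝ)), integrableOn_union]
  simp only [finrank_euclideanSpace_fin, smul_eq_mul]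
  constructor
  · have h : IntegrableOn (fun y : ℝ => y ^ (1 - 2 * s)) (Ioc 0 1) := by
      rw [← intervalIntegrable_iff_integrableOn_Ioc_of_le zero_le_one]
      exact intervalIntegral.intervalIntegrable_rpow' (by linarith)
    refine h.congr_fun (fun y hy => ?_) measurableSet_Ioc
    rw [cutWeight_of_le_one (by linarith) hy.1.le hy.2 (by linarith)]
    have e : y ^ (k - 1) * (y ^ 2 * y ^ (-((k : ℝ) + 2 * s)))
        = y ^ 2 * (y ^ (k - 1) * y ^ (-((k : ℝ) + 2 * s))) := by ring
    rw [e, pow_mul_rpow_eq hk _ hy.1, ← Real.rpow_natCast y 2, ← Real.rpow_add hy.1]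
    push_cast
    ring_nf
  · have h : IntegrableOn (fun y : ℝ => y ^ (-1 - s)) (Ioi 1) :=
      integrableOn_Ioi_rpow_of_lt (by linarith) one_pos
    refine h.congr_fun (fun y hy => ?_) measurableSet_Ioi
    have hy0 : 0 < y := one_pos.trans hy
    rw [cutWeight_of_one_le (by linarith) (le_of_lt hy)]
    have e : y ^ (k - 1) * (y ^ s * y ^ (-((k : ℝ) + 2 * s)))
        = y ^ s * (y ^ (k - 1) * y ^ (-((k : ℝ) + 2 * s))) := by ring
    rw [e, pow_mul_rpow_eq hk _ hy0, ← Real.rpow_add hy0]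
    ring_nf

lemma cutWeight_mul_powKernel_comp_smul {R : ℝ} (hR : 0 < R) (τ : EuclideanSpace ℝ (Fin k)) :
    cutWeight s (‖R⁻¹ • τ‖) * powKernel a (R⁻¹ • τ)
      = R ^ ((k : ℝ) + a) * (cutWeight s (‖τ‖ / R) * powKernel a τ) := by
  rw [powKernel_smul _ (inv_pos.2 hR), norm_smul, Real.norm_of_nonneg (inv_pos.2 hR).le,
    Real.inv_rpow hR.le, ← Real.rpow_neg hR.le, neg_neg, inv_mul_eq_div]
  ring

lemma integrable_cutWeight (hk : 1 ≤ k) (hs : 1 / 2 < s) (hs1 : s < 1) {R : ℝ} (hR : 0 < R) :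
    Integrable fun τ : EuclideanSpace ℝ (Fin k) =>
      cutWeight s (‖τ‖ / R) * powKernel (2 * s) τ := by
  have h := (integrable_cutWeight_one hk hs hs1).comp_smul (inv_pos.2 hR).ne'
  simp only [cutWeight_mul_powKernel_comp_smul hR] at h
  have h2 := h.const_mul ((R ^ ((k : ℝ) + 2 * s))⁻¹)
  refine h2.congr (Eventually.of_forall fun τ => ?_)
  have : R ^ ((k : ℝ) + 2 * s) ≠ 0 := (Real.rpow_pos_of_pos hR _).ne'
  simp only
  field_simp

lemma integral_cutWeight (k : ℕ) (s : ℝ) {R : ℝ} (hR : 0 < R) :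
    ∫ τ : EuclideanSpace ℝ (Fin k), cutWeight s (‖τ‖ / R) * powKernel (2 * s) τ
      = R ^ (-(2 * s)) *
        ∫ τ : EuclideanSpace ℝ (Fin k), cutWeight s ‖τ‖ * powKernel (2 * s) τ := by
  have h := Measure.integral_comp_smul (volume : Measure (EuclideanSpace ℝ (Fin k)))
    (fun τ => cutWeight s ‖τ‖ * powKernel (2 * s) τ) R⁻¹
  simp only [cutWeight_mul_powKernel_comp_smul hR, integral_const_mul, finrank_euclideanSpace_fin,
    smul_eq_mul, inv_pow, inv_inv, abs_of_pos (pow_pos hR k)] at h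
  have h1 : R ^ ((k : ℝ) + 2 * s) = R ^ k * R ^ (2 * s) := by
    rw [Real.rpow_add hR, Real.rpow_natCast]
  rw [h1, mul_assoc] at h
  have h2 := mul_left_cancel₀ (pow_pos hR k).ne' h
  rw [Real.rpow_neg hR.le, ← h2, inv_mul_cancel_left₀ (Real.rpow_pos_of_pos hR _).ne']

/-- The kernel of order `a > 0` is integrable away from the origin. -/
lemma integrableOn_powKernel_compl_ball_one (hk : 1 ≤ k) (ha : 0 < a) :
    IntegrableOn (powKernel a) {τ : EuclideanSpace ℝ (Fin k) | 1 < ‖τ‖} := by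
  have := nontrivial_euclideanSpace hk
  have hm : MeasurableSet {τ : EuclideanSpace ℝ (Fin k) | 1 < ‖τ‖} :=
    measurableSet_lt measurable_const measurable_norm
  rw [← integrable_indicator_iff hm]
  have e : {τ : EuclideanSpace ℝ (Fin k) | 1 < ‖τ‖}.indicator (powKernel a)
      = fun τ => (Ioi (1 : ℝ)).indicator (fun y => y ^ (-((k : ℝ) + a))) ‖τ‖ := by
    ext τ; simp [indicator, powKernel]
  rw [e, integrable_fun_norm_addHaar volume]
  simp only [finrank_euclideanSpace_fin, smul_eq_mul]
  rw [← Ioc_union_Ioi_eq_Ioi (zero_le_one (α := ℝ)), integrableOn_union]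
  constructor
  · refine integrableOn_zero.congr_fun (fun y hy => ?_) measurableSet_Ioc
    simp [indicator, hy.2]
  · have h : IntegrableOn (fun y : ℝ => y ^ (-1 - a)) (Ioi 1) :=
      integrableOn_Ioi_rpow_of_lt (by linarith) one_pos
    refine h.congr_fun (fun y hy => ?_) measurableSet_Ioi
    have hy0 : 0 < y := one_pos.trans hy
    rw [indicator_of_mem hy, pow_mul_rpow_eq hk _ hy0]
    ring_nf

lemma smul_compl_ball_one {R : ℝ} (hR : 0 < R) :
    R • {τ : EuclideanSpace ℝ (Fin k) | 1 < ‖τ‖} = {τ | R < ‖τ‖} := by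
  ext τ
  rw [mem_smul_set_iff_inv_smul_mem₀ hR.ne', mem_ofPred_eq, mem_ofPred_eq, norm_smul,
    Real.norm_of_nonneg (inv_pos.2 hR).le, ← div_eq_inv_mul, one_lt_div hR]

lemma integrableOn_powKernel (hk : 1 ≤ k) (ha : 0 < a) {R : ℝ} (hR : 0 < R) :
    IntegrableOn (powKernel a) {τ : EuclideanSpace ℝ (Fin k) | R < ‖τ‖} := by
  have hm : ∀ r : ℝ, MeasurableSet {τ : EuclideanSpace ℝ (Fin k) | r < ‖τ‖} := fun r =>
    measurableSet_lt measurable_const measurable_norm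
  have h := ((integrable_indicator_iff (hm 1)).2
    (integrableOn_powKernel_compl_ball_one hk ha)).comp_smul (inv_pos.2 hR).ne'
  have hc : R⁻¹ ^ (-((k : ℝ) + a)) ≠ 0 := (Real.rpow_pos_of_pos (inv_pos.2 hR) _).ne'
  rw [← integrable_indicator_iff (hm R)]
  refine (h.const_mul (R⁻¹ ^ (-((k : ℝ) + a)))⁻¹).congr (Eventually.of_forall fun τ => ?_)
  have e : 1 < ‖R⁻¹ • τ‖ ↔ R < ‖τ‖ := by
    rw [norm_smul, Real.norm_of_nonneg (inv_pos.2 hR).le, ← div_eq_inv_mul, one_lt_div hR]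
  by_cases hτ : R < ‖τ‖
  · simp only [indicator, mem_ofPred_eq, e.2 hτ, hτ, if_true, powKernel_smul a (inv_pos.2 hR)]
    field_simp
  · simp [indicator, e, hτ]

lemma setIntegral_powKernel (k : ℕ) (a : ℝ) {R : ℝ} (hR : 0 < R) :
    ∫ τ in {τ : EuclideanSpace ℝ (Fin k) | R < ‖τ‖}, powKernel a τ
      = R ^ (-a) * ∫ τ in {τ : EuclideanSpace ℝ (Fin k) | 1 < ‖τ‖}, powKernel a τ := by
  have h := Measure.setIntegral_comp_smul_of_pos (volume : Measure (EuclideanSpace ℝ (Fin k)))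
    (powKernel a) {τ | 1 < ‖τ‖} hR
  rw [smul_compl_ball_one hR] at h
  simp only [powKernel_smul a hR, integral_const_mul, finrank_euclideanSpace_fin,
    smul_eq_mul] at h
  have h1 : R ^ (-((k : ℝ) + a)) = (R ^ k)⁻¹ * R ^ (-a) := by
    rw [neg_add, Real.rpow_add hR, Real.rpow_neg hR.le, Real.rpow_natCast]
  rw [h1, mul_assoc] at h
  exact (mul_left_cancel₀ (inv_pos.2 (pow_pos hR k)).ne' h).symm

lemma setIntegral_powKernel_pos (hk : 1 ≤ k) (ha : 0 < a) :
    0 < ∫ τ in {τ : EuclideanSpace ℝ (Fin k) | 1 < ‖τ‖}, powKernel a τ := by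
  have := nontrivial_euclideanSpace hk
  have ho : IsOpen {τ : EuclideanSpace ℝ (Fin k) | 1 < ‖τ‖} :=
    isOpen_lt continuous_const continuous_norm
  rw [setIntegral_pos_iff_support_of_nonneg_ae (Eventually.of_forall fun τ => powKernel_nonneg a τ)
    (integrableOn_powKernel_compl_ball_one hk ha)]
  have e : Function.support (powKernel a) ∩ {τ : EuclideanSpace ℝ (Fin k) | 1 < ‖τ‖}
      = {τ | 1 < ‖τ‖} := by
    refine inter_eq_right.2 fun τ hτ => ?_
    exact (Real.rpow_pos_of_pos (one_pos.trans hτ) _).ne'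
  rw [e]
  refine ho.measure_pos _ ?_
  obtain ⟨x, hx⟩ := NormedSpace.exists_lt_norm ℝ (EuclideanSpace ℝ (Fin k)) 1
  exact ⟨x, hx⟩

end Kernel

/-! ### Extended integrals -/

section ExtIntegral

variable {α : Type*} [MeasurableSpace α] {μ : Measure α} {f g : α → ℝ}

lemma extIntegral_of_integrable (hf : Integrable f μ) :
    extIntegral μ f = ((∫ a, f a ∂μ : ℝ) : EReal) := by
  have h1 : ∫⁻ a, ENNReal.ofReal (f a) ∂μ ≠ ⊤ := hf.lintegral_lt_top.ne
  have h2 : ∫⁻ a, ENNReal.ofReal (-f a) ∂μ ≠ ⊤ := hf.neg.lintegral_lt_top.ne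
  rw [integral_eq_lintegral_pos_part_sub_lintegral_neg_part hf, extIntegral, EReal.coe_sub,
    EReal.coe_ennreal_toReal h1, EReal.coe_ennreal_toReal h2]

lemma extIntegral_mono (h : ∀ᵐ a ∂μ, f a ≤ g a) : extIntegral μ f ≤ extIntegral μ g := by
  refine EReal.sub_le_sub ?_ ?_
  · exact_mod_cast lintegral_mono_ae (h.mono fun a ha => ENNReal.ofReal_le_ofReal ha)
  · exact_mod_cast lintegral_mono_ae
      (h.mono fun a ha => ENNReal.ofReal_le_ofReal (neg_le_neg ha))

lemma extIntegral_of_nonneg (h : ∀ a, 0 ≤ f a) :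
    extIntegral μ f = ((∫⁻ a, ENNReal.ofReal (f a) ∂μ : ℝ≥0∞) : EReal) := by
  have : ∀ a, ENNReal.ofReal (-f a) = 0 := fun a =>
    ENNReal.ofReal_of_nonpos (neg_nonpos.2 (h a))
  simp [extIntegral, this]

end ExtIntegral

/-! ### The symmetrized integral -/

/-- A `C²` function vanishing to first order at a point is quadratically small near it. -/
lemma exists_sq_bound {E : Type*} [NormedAddCommGroup E] [NormedSpace ℝ E] {g : E → ℝ} {x : E}
    (hg : ContDiffAt ℝ 2 g x) (h0 : g x = 0) (h1 : fderiv ℝ g x = 0) :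
    ∃ C, 0 ≤ C ∧ ∃ r, 0 < r ∧ ∀ y, ‖y - x‖ < r → |g y| ≤ C * ‖y - x‖ ^ 2 := by
  have hd : DifferentiableAt ℝ (fderiv ℝ g) x :=
    (hg.fderiv_right (m := 1) (by norm_num)).differentiableAt (by norm_num)
  obtain ⟨C, hC, hb⟩ := hd.isBigO_sub.exists_nonneg
  have he := (hg.eventually (by simp)).and hb.bound
  obtain ⟨r, hr, h⟩ := Metric.eventually_nhds_iff_ball.1 he
  refine ⟨C, hC, r, hr, fun y hy => ?_⟩
  have hsub : Metric.closedBall x ‖y - x‖ ⊆ Metric.ball x r :=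
    Metric.closedBall_subset_ball hy
  have key := (convex_closedBall x ‖y - x‖).norm_image_sub_le_of_norm_fderiv_le (𝕜 := ℝ) (f := g)
    (C := C * ‖y - x‖) (x := x) (y := y)
    (fun z hz => (h z (hsub hz)).1.differentiableAt (by norm_num))
    (fun z hz => by
      have h2 := (h z (hsub hz)).2
      rw [h1, sub_zero] at h2
      refine h2.trans (mul_le_mul_of_nonneg_left ?_ hC)
      simpa [dist_eq_norm] using hz)
    (Metric.mem_closedBall_self (norm_nonneg _)) (by simp [dist_eq_norm])
  rw [h0, sub_zero, Real.norm_eq_abs] at key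
  calc |g y| ≤ C * ‖y - x‖ * ‖y - x‖ := key
    _ = C * ‖y - x‖ ^ 2 := by ring

section Sym

variable {k : ℕ} {s : ℝ} {F : EuclideanSpace ℝ (Fin k) → ℝ} {e : EuclideanSpace ℝ (Fin k)} {B : ℝ}

/-- Half of the centred second difference of `F` at `e` in the direction `τ`. -/
def symDiff (F : EuclideanSpace ℝ (Fin k) → ℝ) (e τ : EuclideanSpace ℝ (Fin k)) : ℝ :=
  (F (e + τ) + F (e - τ) - 2 * F e) / 2

/-- The fractional Laplacian `-(-Δ)^s F (e)` on `ℝ^k` up to its normalizing constant, the principal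
value being taken in symmetrized form over the whole space. -/
def symIntegral (s : ℝ) (F : EuclideanSpace ℝ (Fin k) → ℝ) (e : EuclideanSpace ℝ (Fin k)) : ℝ :=
  ∫ τ, symDiff F e τ * powKernel (2 * s) τ

lemma exists_symDiff_bound (hs0 : 0 < s) (hs1 : s < 1) (hB : ∀ y, |F y| ≤ B)
    (hF : ContDiffAt ℝ 2 F e) :
    ∃ C r, 0 < r ∧ ∀ τ, |symDiff F e τ| ≤ C * cutWeight s (‖τ‖ / r) := by
  have c1 : ContDiffAt ℝ 2 (fun τ => F (e + τ)) 0 :=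
    ContDiffAt.comp (0 : EuclideanSpace ℝ (Fin k)) (g := F) (by simpa using hF) (by fun_prop)
  have c2 : ContDiffAt ℝ 2 (fun τ => F (e - τ)) 0 :=
    ContDiffAt.comp (0 : EuclideanSpace ℝ (Fin k)) (g := F) (by simpa using hF) (by fun_prop)
  have hg : ContDiffAt ℝ 2 (symDiff F e) 0 :=
    ((c1.add c2).sub contDiffAt_const).div_const 2
  have hd : HasFDerivAt F (fderiv ℝ F e) e := (hF.differentiableAt (by norm_num)).hasFDerivAt
  have d1 : HasFDerivAt (fun τ => F (e + τ)) (fderiv ℝ F e) 0 := by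
    have := (show HasFDerivAt F (fderiv ℝ F e) (e + 0) by simpa using hd).comp
      (0 : EuclideanSpace ℝ (Fin k)) ((hasFDerivAt_id _).const_add e)
    simpa using! this
  have d2 : HasFDerivAt (fun τ => F (e - τ)) (-fderiv ℝ F e) 0 := by
    have := (show HasFDerivAt F (fderiv ℝ F e) (e - 0) by simpa using hd).comp
      (0 : EuclideanSpace ℝ (Fin k)) ((hasFDerivAt_id _).const_sub e)
    simpa using! this
  have h1 : fderiv ℝ (symDiff F e) 0 = 0 := by
    have := (((d1.add d2).sub (hasFDerivAt_const (2 * F e) _)).mul_const (1 / 2 : ℝ)).fderiv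
    have e1 : symDiff F e = fun τ => (F (e + τ) + F (e - τ) - 2 * F e) * (1 / 2 : ℝ) := by
      ext τ; simp [symDiff, div_eq_mul_inv]
    rw [e1]
    refine this.trans ?_
    simp
  obtain ⟨C, hC, r, hr, h⟩ := exists_sq_bound hg (by simp [symDiff]; ring) h1
  refine ⟨max (C * r ^ 2) (2 * B), r, hr, fun τ => ?_⟩
  have hw : 0 ≤ cutWeight s (‖τ‖ / r) := cutWeight_nonneg (by positivity)
  rcases lt_or_ge ‖τ‖ r with hτ | hτ
  · calc |symDiff F e τ| ≤ C * ‖τ‖ ^ 2 := by simpa using h τ (by simpa using hτ)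
      _ = C * r ^ 2 * cutWeight s (‖τ‖ / r) := by
        rw [cutWeight_of_le_one (by linarith) (by positivity) ((div_le_one hr).2 hτ.le) hs0.ne']
        field_simp
      _ ≤ _ := mul_le_mul_of_nonneg_right (le_max_left _ _) hw
  · have hB0 : 0 ≤ B := (abs_nonneg _).trans (hB 0)
    have h2 : |symDiff F e τ| ≤ 2 * B := by
      have a1 := abs_le.1 (hB (e + τ))
      have a2 := abs_le.1 (hB (e - τ))
      have a3 := abs_le.1 (hB e)
      unfold symDiff
      rw [abs_le]; constructor <;> linarith [a1.1, a1.2, a2.1, a2.2, a3.1, a3.2]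
    calc |symDiff F e τ| ≤ 2 * B * 1 := by linarith
      _ ≤ 2 * B * cutWeight s (‖τ‖ / r) :=
        mul_le_mul_of_nonneg_left (one_le_cutWeight hs0.le ((one_le_div hr).2 hτ)) (by linarith)
      _ ≤ _ := mul_le_mul_of_nonneg_right (le_max_right _ _) hw

lemma measurable_symDiff (hFm : Measurable F) (e : EuclideanSpace ℝ (Fin k)) :
    Measurable (symDiff F e) := by
  unfold symDiff; fun_prop

/-- A function of `τ` dominated by `cutWeight` is integrable against the kernel. -/
lemma integrable_of_le_cutWeight (hk : 1 ≤ k) (hs : 1 / 2 < s) (hs1 : s < 1)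
    {g : EuclideanSpace ℝ (Fin k) → ℝ} (hgm : Measurable g) {C r : ℝ} (hr : 0 < r)
    (hg : ∀ τ, |g τ| ≤ C * cutWeight s (‖τ‖ / r)) :
    Integrable fun τ => g τ * powKernel (2 * s) τ := by
  refine ((integrable_cutWeight hk hs hs1 hr).const_mul C).mono'
    (hgm.mul (measurable_powKernel _)).aestronglyMeasurable (Eventually.of_forall fun τ => ?_)
  rw [Real.norm_eq_abs, abs_mul, abs_of_nonneg (powKernel_nonneg _ τ), ← mul_assoc]
  exact mul_le_mul_of_nonneg_right (hg τ) (powKernel_nonneg _ τ)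

lemma integrable_symDiff (hk : 1 ≤ k) (hs : 1 / 2 < s) (hs1 : s < 1) (hFm : Measurable F)
    (hB : ∀ y, |F y| ≤ B) (hF : ContDiffAt ℝ 2 F e) :
    Integrable fun τ => symDiff F e τ * powKernel (2 * s) τ := by
  obtain ⟨C, r, hr, h⟩ := exists_symDiff_bound (by linarith) hs1 hB hF
  exact integrable_of_le_cutWeight hk hs hs1 (measurable_symDiff hFm e) hr h

lemma integrableOn_diff (hk : 1 ≤ k) (hs : 0 < s) (hFm : Measurable F)
    (hB : ∀ y, |F y| ≤ B) (e : EuclideanSpace ℝ (Fin k)) {ε : ℝ} (hε : 0 < ε) :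
    IntegrableOn (fun τ => (F (e + τ) - F e) * powKernel (2 * s) τ) {τ | ε < ‖τ‖} := by
  refine ((integrableOn_powKernel hk (by linarith : 0 < 2 * s) hε).const_mul (2 * B)).mono'
    (Measurable.aestronglyMeasurable ?_) (Eventually.of_forall fun τ => ?_)
  · have := measurable_powKernel (k := k) (2 * s)
    fun_prop
  · rw [Real.norm_eq_abs, abs_mul, abs_of_nonneg (powKernel_nonneg _ τ)]
    refine mul_le_mul_of_nonneg_right ?_ (powKernel_nonneg _ τ)
    exact (abs_sub _ _).trans (by linarith [hB (e + τ), hB e])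

/-- On sets symmetric about the origin the kernel does not see the difference between `F (e + τ)`
and its symmetrization. -/
lemma setIntegral_symDiff {D : Set (EuclideanSpace ℝ (Fin k))} (hD : -D = D)
    (hi : IntegrableOn (fun τ => (F (e + τ) - F e) * powKernel (2 * s) τ) D) :
    ∫ τ in D, symDiff F e τ * powKernel (2 * s) τ
      = ∫ τ in D, (F (e + τ) - F e) * powKernel (2 * s) τ := by
  have mp := Measure.measurePreserving_neg (volume : Measure (EuclideanSpace ℝ (Fin k)))
  have me := (MeasurableEquiv.neg (EuclideanSpace ℝ (Fin k))).measurableEmbedding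
  have hpre : (Neg.neg : EuclideanSpace ℝ (Fin k) → EuclideanSpace ℝ (Fin k)) ⁻¹' D = D := hD
  have i2 : IntegrableOn (fun τ => (F (e - τ) - F e) * powKernel (2 * s) τ) D := by
    have := (mp.integrableOn_comp_preimage me).2 hi
    rw [hpre] at this
    refine this.congr (Eventually.of_forall fun τ => ?_)
    simp [powKernel_neg, sub_eq_add_neg]
  have e2 : ∫ τ in D, (F (e - τ) - F e) * powKernel (2 * s) τ
      = ∫ τ in D, (F (e + τ) - F e) * powKernel (2 * s) τ := by
    have := mp.setIntegral_preimage_emb me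
      (fun τ => (F (e + τ) - F e) * powKernel (2 * s) τ) D
    rw [hpre] at this
    rw [← this]
    refine integral_congr_ae (Eventually.of_forall fun τ => ?_)
    simp [powKernel_neg, sub_eq_add_neg]
  have e3 : ∀ τ, symDiff F e τ * powKernel (2 * s) τ
      = ((F (e + τ) - F e) * powKernel (2 * s) τ + (F (e - τ) - F e) * powKernel (2 * s) τ) / 2 :=
    fun τ => by unfold symDiff; ring
  simp_rw [e3]
  rw [integral_div, integral_add hi i2, e2]
  ring

lemma neg_setOf_norm (P : ℝ → Prop) :
    -{τ : EuclideanSpace ℝ (Fin k) | P ‖τ‖} = {τ | P ‖τ‖} := by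
  ext τ; simp

/-- The symmetrized integral splits at any radius `δ` into the two parts that enter the notion of
viscosity supersolution. -/
lemma symIntegral_eq_add (hk : 1 ≤ k) (hs : 1 / 2 < s) (hs1 : s < 1) (hFm : Measurable F)
    (hB : ∀ y, |F y| ≤ B) (hF : ContDiffAt ℝ 2 F e) {δ : ℝ} (hδ : 0 < δ) :
    symIntegral s F e = (∫ τ in {τ | ‖τ‖ < δ}, symDiff F e τ * powKernel (2 * s) τ)
      + ∫ τ in {τ | δ ≤ ‖τ‖}, (F (e + τ) - F e) * powKernel (2 * s) τ := by
  have hi := integrable_symDiff hk hs hs1 hFm hB hF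
  have hm : MeasurableSet {τ : EuclideanSpace ℝ (Fin k) | ‖τ‖ < δ} :=
    measurableSet_lt measurable_norm measurable_const
  have hio : IntegrableOn (fun τ => (F (e + τ) - F e) * powKernel (2 * s) τ) {τ | δ ≤ ‖τ‖} :=
    (integrableOn_diff hk (by linarith) hFm hB e (half_pos hδ)).mono_set
      fun τ (hτ : δ ≤ ‖τ‖) => (half_lt_self hδ).trans_le hτ
  rw [← setIntegral_symDiff (neg_setOf_norm (δ ≤ ·)) hio, symIntegral,
    ← integral_add_compl hm hi]
  congr 3
  ext τ; simp

variable {N : ℕ} {u φ : EuclideanSpace ℝ (Fin N) → ℝ} {x : EuclideanSpace ℝ (Fin N)}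
  {ξ : Fin k → EuclideanSpace ℝ (Fin N)} {δ : ℝ}

/-- Lower bound for the evaluation along a frame by the operator on `ℝ^k`. -/
lemma symIntegral_le_evaluation (hk : 1 ≤ k) (hs : 1 / 2 < s) (hs1 : s < 1) (hFm : Measurable F)
    (hB : ∀ y, |F y| ≤ B) (hF : ContDiffAt ℝ 2 F e) (hδ : 0 < δ)
    (hin : ∀ τ, ‖τ‖ < δ → symDiff F e τ ≤
      (φ (x + framePoint ξ τ) + φ (x - framePoint ξ τ) - 2 * φ x) / 2)
    (hout : ∀ τ, δ ≤ ‖τ‖ → F (e + τ) - F e ≤ u (x + framePoint ξ τ) - u x) :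
    ((normConst k s * symIntegral s F e : ℝ) : EReal)
      ≤ innerPart s ξ φ x δ + outerPart s ξ u x δ := by
  have hc := (normConst_pos k (by linarith : 0 < s) hs1).le
  have hi := (integrable_symDiff hk hs hs1 hFm hB hF).const_mul (normConst k s)
  have hio : IntegrableOn (fun τ => normConst k s * ((F (e + τ) - F e) * powKernel (2 * s) τ))
      {τ | δ ≤ ‖τ‖} :=
    ((integrableOn_diff hk (by linarith) hFm hB e (half_pos hδ)).mono_set
      fun τ (hτ : δ ≤ ‖τ‖) => (half_lt_self hδ).trans_le hτ).const_mul _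
  have hm1 : MeasurableSet {τ : EuclideanSpace ℝ (Fin k) | ‖τ‖ < δ} :=
    measurableSet_lt measurable_norm measurable_const
  have hm2 : MeasurableSet {τ : EuclideanSpace ℝ (Fin k) | δ ≤ ‖τ‖} :=
    measurableSet_le measurable_const measurable_norm
  rw [symIntegral_eq_add hk hs hs1 hFm hB hF hδ, mul_add, EReal.coe_add, ← integral_const_mul,
    ← integral_const_mul, ← extIntegral_of_integrable hi.integrableOn,
    ← extIntegral_of_integrable hio]
  refine add_le_add (extIntegral_mono ?_) (extIntegral_mono ?_)
  · filter_upwards [ae_restrict_mem hm1] with τ hτ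
    rw [kernel_eq, mul_left_comm]
    exact mul_le_mul_of_nonneg_right (hin τ hτ) (mul_nonneg hc (powKernel_nonneg _ _))
  · filter_upwards [ae_restrict_mem hm2] with τ hτ
    rw [kernel_eq, mul_left_comm]
    exact mul_le_mul_of_nonneg_right (hout τ hτ) (mul_nonneg hc (powKernel_nonneg _ _))

/-- Upper bound for the evaluation along a frame by the operator on `ℝ^k`. -/
lemma evaluation_le_symIntegral (hk : 1 ≤ k) (hs : 1 / 2 < s) (hs1 : s < 1) (hFm : Measurable F)
    (hB : ∀ y, |F y| ≤ B) (hF : ContDiffAt ℝ 2 F e) (hδ : 0 < δ)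
    (hin : ∀ τ, ‖τ‖ < δ →
      (φ (x + framePoint ξ τ) + φ (x - framePoint ξ τ) - 2 * φ x) / 2 ≤ symDiff F e τ)
    (hout : ∀ τ, δ ≤ ‖τ‖ → u (x + framePoint ξ τ) - u x ≤ F (e + τ) - F e) :
    innerPart s ξ φ x δ + outerPart s ξ u x δ
      ≤ ((normConst k s * symIntegral s F e : ℝ) : EReal) := by
  have hc := (normConst_pos k (by linarith : 0 < s) hs1).le
  have hi := (integrable_symDiff hk hs hs1 hFm hB hF).const_mul (normConst k s)
  have hio : IntegrableOn (fun τ => normConst k s * ((F (e + τ) - F e) * powKernel (2 * s) τ))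
      {τ | δ ≤ ‖τ‖} :=
    ((integrableOn_diff hk (by linarith) hFm hB e (half_pos hδ)).mono_set
      fun τ (hτ : δ ≤ ‖τ‖) => (half_lt_self hδ).trans_le hτ).const_mul _
  have hm1 : MeasurableSet {τ : EuclideanSpace ℝ (Fin k) | ‖τ‖ < δ} :=
    measurableSet_lt measurable_norm measurable_const
  have hm2 : MeasurableSet {τ : EuclideanSpace ℝ (Fin k) | δ ≤ ‖τ‖} :=
    measurableSet_le measurable_const measurable_norm
  rw [symIntegral_eq_add hk hs hs1 hFm hB hF hδ, mul_add, EReal.coe_add, ← integral_const_mul,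
    ← integral_const_mul, ← extIntegral_of_integrable hi.integrableOn,
    ← extIntegral_of_integrable hio]
  refine add_le_add (extIntegral_mono ?_) (extIntegral_mono ?_)
  · filter_upwards [ae_restrict_mem hm1] with τ hτ
    rw [kernel_eq, mul_left_comm (normConst k s)]
    exact mul_le_mul_of_nonneg_right (hin τ hτ) (mul_nonneg hc (powKernel_nonneg _ _))
  · filter_upwards [ae_restrict_mem hm2] with τ hτ
    rw [kernel_eq, mul_left_comm (normConst k s)]
    exact mul_le_mul_of_nonneg_right (hout τ hτ) (mul_nonneg hc (powKernel_nonneg _ _))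

end Sym

/-! ### Radial functions and inversion -/

section Inversion

variable {k : ℕ} {s : ℝ} {f : ℝ → ℝ} {e : EuclideanSpace ℝ (Fin k)} {B : ℝ}

/-- Cutting out the sublevel sets of a function that is positive almost everywhere exhausts an
integral. -/
lemma tendsto_setIntegral_superlevel {α : Type*} [MeasurableSpace α] {μ : Measure α} {g w : α → ℝ}
    {A : Set α} (hw : Measurable w) (hpos : ∀ᵐ y ∂μ.restrict A, 0 < w y)
    (hi : IntegrableOn g A μ) :
    Tendsto (fun ε : ℝ => ∫ y in A ∩ {y | ε < w y}, g y ∂μ) (𝓝[>] 0) (𝓝 (∫ y in A, g y ∂μ)) := by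
  have hm : ∀ ε : ℝ, MeasurableSet {y | ε < w y} := fun ε => measurableSet_lt measurable_const hw
  have e1 : ∀ ε : ℝ, ∫ y in A ∩ {y | ε < w y}, g y ∂μ
      = ∫ y in A, {y | ε < w y}.indicator g y ∂μ := fun ε => by
    rw [setIntegral_indicator (hm ε)]
  simp_rw [e1]
  refine tendsto_integral_filter_of_dominated_convergence (fun y => ‖g y‖)
    (Eventually.of_forall fun ε => hi.aestronglyMeasurable.indicator (hm ε))
    (Eventually.of_forall fun ε => Eventually.of_forall fun y => norm_indicator_le_norm_self _ _)
    hi.norm ?_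
  filter_upwards [hpos] with y hy
  refine tendsto_const_nhds.congr' ?_
  filter_upwards [Ioo_mem_nhdsGT hy] with ε hε
  rw [indicator_of_mem (show y ∈ {y | ε < w y} from hε.2)]

/-- The integrand obtained by folding a radial function along the inversion in the sphere of radius
`ρ`: the value at radius `r > ρ` collects the increments from `ρ` to `r` and from `ρ` to `ρ²/r`, the
latter with the conformal factor `(r/ρ)^{-β}`, where `β = k - 2s` on `ℝ^k`. -/
def foldedIncrement (β : ℝ) (f : ℝ → ℝ) (ρ r : ℝ) : ℝ :=
  f r - f ρ + (f (ρ ^ 2 / r) - f ρ) * (r / ρ) ^ (-β)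

/-- The two first-order terms of the folded increment cancel. -/
lemma foldedIncrement_sq_bound {ρ : ℝ} (hρ : 0 < ρ) (β : ℝ) (hf : ContDiffAt ℝ 2 f ρ) :
    ∃ C, 0 ≤ C ∧ ∃ η, 0 < η ∧ ∀ r, |r - ρ| < η →
      |foldedIncrement β f ρ r| ≤ C * |r - ρ| ^ 2 := by
  have hq : ρ ^ 2 / ρ = ρ := by field_simp
  have c1 : ContDiffAt ℝ 2 (fun r : ℝ => ρ ^ 2 / r) ρ :=
    contDiffAt_const.div contDiffAt_id hρ.ne'
  have c2 : ContDiffAt ℝ 2 (fun r : ℝ => f (ρ ^ 2 / r)) ρ :=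
    ContDiffAt.comp ρ (g := f) (by rw [hq]; exact hf) c1
  have c3 : ContDiffAt ℝ 2 (fun r : ℝ => (r / ρ) ^ (-β)) ρ :=
    (contDiffAt_id.div_const ρ).rpow_const_of_ne (by simp [hρ.ne'])
  have hg : ContDiffAt ℝ 2 (foldedIncrement β f ρ) ρ :=
    (hf.sub contDiffAt_const).add ((c2.sub contDiffAt_const).mul c3)
  have hd : HasDerivAt f (deriv f ρ) ρ := (hf.differentiableAt (by norm_num)).hasDerivAt
  have d1 : HasDerivAt (fun r : ℝ => ρ ^ 2 / r) (-1) ρ := by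
    have := (hasDerivAt_inv hρ.ne').const_mul (ρ ^ 2)
    simp only [← div_eq_mul_inv] at this
    convert! this using 1
    field_simp
  have d2 : HasDerivAt (fun r : ℝ => f (ρ ^ 2 / r)) (deriv f ρ * (-1)) ρ :=
    HasDerivAt.comp ρ (h₂ := f) (by rw [hq]; exact hd) d1
  have d3 := (c3.differentiableAt (by norm_num)).hasDerivAt
  have d4 : HasDerivAt (foldedIncrement β f ρ) 0 ρ := by
    have := (hd.sub_const (f ρ)).add ((d2.sub_const (f ρ)).mul d3)
    convert! this using 1
    simp [hq, div_self hρ.ne']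
  have h1 : fderiv ℝ (foldedIncrement β f ρ) ρ = 0 := by
    ext; simp [d4.deriv]
  have h0 : foldedIncrement β f ρ ρ = 0 := by simp [foldedIncrement, hq]
  exact exists_sq_bound hg h0 h1

lemma abs_foldedIncrement_le (hB : ∀ r, |f r| ≤ B) {ρ r β : ℝ} (hρ : 0 < ρ) (hr : ρ ≤ r)
    (hβ : 0 ≤ β) : |foldedIncrement β f ρ r| ≤ 4 * B := by
  have hB0 : 0 ≤ B := (abs_nonneg _).trans (hB 0)
  have h1 : (r / ρ) ^ (-β) ≤ 1 :=
    Real.rpow_le_one_of_one_le_of_nonpos ((one_le_div hρ).2 hr) (by linarith)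
  have h2 : 0 ≤ (r / ρ) ^ (-β) := Real.rpow_nonneg (div_nonneg (hρ.le.trans hr) hρ.le) _
  have h3 : ∀ a b, |f a - f b| ≤ 2 * B := fun a b =>
    (abs_sub _ _).trans (by linarith [hB a, hB b])
  calc |foldedIncrement β f ρ r|
      ≤ |f r - f ρ| + |(f (ρ ^ 2 / r) - f ρ) * (r / ρ) ^ (-β)| := abs_add_le _ _
    _ ≤ 2 * B + 2 * B * 1 := by
      rw [abs_mul, abs_of_nonneg h2]
      exact add_le_add (h3 _ _) (mul_le_mul (h3 _ _) h1 h2 (by linarith))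
    _ = 4 * B := by ring

lemma measurable_foldedIncrement (hf : Measurable f) (β ρ : ℝ) :
    Measurable (foldedIncrement β f ρ) := by
  unfold foldedIncrement; fun_prop

lemma measurableSet_norm_gt (R : ℝ) : MeasurableSet {y : EuclideanSpace ℝ (Fin k) | R < ‖y‖} :=
  measurableSet_lt measurable_const measurable_norm

lemma integrableOn_foldedIncrement (hk : 1 ≤ k) (hs : 1 / 2 < s) (hs1 : s < 1) {β : ℝ}
    (hβ : 0 ≤ β) (hfm : Measurable f) (hB : ∀ r, |f r| ≤ B) (he : e ≠ 0)
    (hf : ContDiffAt ℝ 2 f ‖e‖) :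
    IntegrableOn (fun y => foldedIncrement β f ‖e‖ ‖y‖ * powKernel (2 * s) (y - e))
      {y | ‖e‖ < ‖y‖} := by
  have hρ : 0 < ‖e‖ := norm_pos_iff.2 he
  obtain ⟨C, hC, η, hη, h⟩ := foldedIncrement_sq_bound hρ β hf
  have hB0 : 0 ≤ B := (abs_nonneg _).trans (hB 0)
  set A := {y : EuclideanSpace ℝ (Fin k) | ‖e‖ < ‖y‖} with hA
  have hAm : MeasurableSet A := measurableSet_norm_gt _
  set g : EuclideanSpace ℝ (Fin k) → ℝ :=
    A.indicator (fun y => foldedIncrement β f ‖e‖ ‖y‖) with hg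
  have hgm : Measurable g :=
    ((measurable_foldedIncrement hfm β ‖e‖).comp measurable_norm).indicator hAm
  have hbd : ∀ τ, |g (τ + e)| ≤ max (C * η ^ 2) (4 * B) * cutWeight s (‖τ‖ / η) := by
    intro τ
    have hw : 0 ≤ cutWeight s (‖τ‖ / η) := cutWeight_nonneg (by positivity)
    by_cases hτ : τ + e ∈ A
    · rw [hg, indicator_of_mem hτ]
      have hle : |‖τ + e‖ - ‖e‖| ≤ ‖τ‖ := by simpa using abs_norm_sub_norm_le (τ + e) e
      rcases lt_or_ge ‖τ‖ η with h1 | h1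
      · calc |foldedIncrement β f ‖e‖ ‖τ + e‖| ≤ C * |‖τ + e‖ - ‖e‖| ^ 2 := h _ (hle.trans_lt h1)
          _ ≤ C * ‖τ‖ ^ 2 := by gcongr
          _ = C * η ^ 2 * cutWeight s (‖τ‖ / η) := by
            rw [cutWeight_of_le_one (by linarith) (by positivity) ((div_le_one hη).2 h1.le)
              (by linarith)]
            field_simp
          _ ≤ _ := mul_le_mul_of_nonneg_right (le_max_left _ _) hw
      · calc |foldedIncrement β f ‖e‖ ‖τ + e‖| ≤ 4 * B * 1 := by
              rw [mul_one]; exact abs_foldedIncrement_le hB hρ (le_of_lt hτ) hβ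
          _ ≤ 4 * B * cutWeight s (‖τ‖ / η) := mul_le_mul_of_nonneg_left
              (one_le_cutWeight (by linarith) ((one_le_div hη).2 h1)) (by linarith)
          _ ≤ _ := mul_le_mul_of_nonneg_right (le_max_right _ _) hw
    · rw [hg, indicator_of_notMem hτ, abs_zero]
      exact mul_nonneg (le_max_of_le_right (by linarith)) hw
  have hi := integrable_of_le_cutWeight hk hs hs1 (hgm.comp (measurable_add_const e)) hη hbd
  have hi2 := hi.comp_sub_right e
  rw [← integrable_indicator_iff hAm]
  refine hi2.congr (Eventually.of_forall fun y => ?_)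
  by_cases hy : y ∈ A <;> simp [hg, hy]

/-- Change of variables under the inversion in the sphere `|y| = |e|`: the part of a cut-off
integral inside the sphere is carried outside, and the kernel is conformally covariant. -/
lemma setIntegral_inversion (hk : 1 ≤ k) (s : ℝ) (f : ℝ → ℝ) (he : e ≠ 0) (ε : ℝ) :
    ∫ y in {y | ‖y‖ < ‖e‖ ∧ ε < ‖y - e‖}, (f ‖y‖ - f ‖e‖) * powKernel (2 * s) (y - e)
      = ∫ y in {y | ‖e‖ < ‖y‖} ∩ {y | ε < ‖e‖ * ‖y - e‖ / ‖y‖},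
        (f (‖e‖ ^ 2 / ‖y‖) - f ‖e‖) * (‖y‖ / ‖e‖) ^ (-((k : ℝ) - 2 * s))
          * powKernel (2 * s) (y - e) := by
  have hρ : 0 < ‖e‖ := norm_pos_iff.2 he
  have := nontrivial_euclideanSpace hk
  set ρ := ‖e‖ with hρdef
  set A : Set (EuclideanSpace ℝ (Fin k)) := {y | ρ < ‖y‖} ∩ {y | ε < ρ * ‖y - e‖ / ‖y‖} with hA
  set ι := EuclideanGeometry.inversion (0 : EuclideanSpace ℝ (Fin k)) ρ with hι
  have hAm : MeasurableSet A := (measurableSet_norm_gt _).inter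
    (measurableSet_lt measurable_const (by fun_prop))
  have hA0 : ∀ y ∈ A, y ≠ 0 := fun y hy => norm_pos_iff.1 (hρ.trans hy.1)
  have hnorm : ∀ y, ‖ι y‖ = ρ ^ 2 / ‖y‖ := fun y => by
    have := EuclideanGeometry.dist_inversion_center (0 : EuclideanSpace ℝ (Fin k)) y ρ
    simpa [dist_eq_norm] using this
  have hιe : ι e = e := EuclideanGeometry.inversion_of_mem_sphere (by simp [hρdef])
  have hdist : ∀ y, y ≠ 0 → ‖ι y - e‖ = ρ * ‖y - e‖ / ‖y‖ := fun y hy => by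
    have h := EuclideanGeometry.dist_inversion_inversion (c := 0) hy he ρ
    rw [← hι, hιe] at h
    simp only [dist_eq_norm, sub_zero, ← hρdef] at h
    have hy' : ‖y‖ ≠ 0 := norm_ne_zero_iff.2 hy
    rw [h]; field_simp
  have himg : ι '' A = {y | y ≠ 0 ∧ ‖y‖ < ρ ∧ ε < ‖y - e‖} := by
    ext z
    constructor
    · rintro ⟨y, hy, rfl⟩
      have hy0 := hA0 y hy
      have hyp : 0 < ‖y‖ := norm_pos_iff.2 hy0
      refine ⟨?_, ?_, ?_⟩
      · rw [← norm_pos_iff, hnorm]; positivity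
      · rw [hnorm, div_lt_iff₀ hyp, sq]; exact mul_lt_mul_of_pos_left hy.1 hρ
      · rw [hdist y hy0]; exact hy.2
    · rintro ⟨hz0, hz1, hz2⟩
      have hzp : 0 < ‖z‖ := norm_pos_iff.2 hz0
      have hii : ι (ι z) = z := EuclideanGeometry.inversion_inversion _ hρ.ne' z
      have hιz : ι z ≠ 0 := by rw [← norm_pos_iff, hnorm]; positivity
      refine ⟨ι z, ⟨?_, ?_⟩, hii⟩
      · rw [mem_ofPred_eq, hnorm, lt_div_iff₀ hzp, sq]; exact mul_lt_mul_of_pos_left hz1 hρ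
      · rw [mem_ofPred_eq, ← hdist _ hιz, hii]; exact hz2
  have hset : ∫ y in {y | ‖y‖ < ρ ∧ ε < ‖y - e‖}, (f ‖y‖ - f ρ) * powKernel (2 * s) (y - e)
      = ∫ y in ι '' A, (f ‖y‖ - f ρ) * powKernel (2 * s) (y - e) := by
    rw [himg]
    refine setIntegral_congr_set ?_
    filter_upwards [compl_mem_ae_iff.2 (measure_singleton (0 : EuclideanSpace ℝ (Fin k)))] with y hy
    have hy0 : y ≠ 0 := hy
    exact propext ⟨fun h => ⟨hy0, h⟩, fun h => h.2⟩
  rw [hset, integral_image_eq_integral_abs_det_fderiv_smul volume hAm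
    (fun y hy => (EuclideanGeometry.hasFDerivAt_inversion (hA0 y hy)).hasFDerivWithinAt)
    ((EuclideanGeometry.inversion_injective _ hρ.ne').injOn)]
  refine setIntegral_congr_fun hAm fun y hy => ?_
  have hy0 := hA0 y hy
  have hyp : 0 < ‖y‖ := norm_pos_iff.2 hy0
  have hdet : |((ρ / dist y 0) ^ 2 • ((ℝ ∙ (y - 0))ᗮ.reflection :
      EuclideanSpace ℝ (Fin k) →L[ℝ] EuclideanSpace ℝ (Fin k))).det| = (ρ / ‖y‖) ^ (2 * k) := by
    have h1 : ((ρ / dist y 0) ^ 2 • ((ℝ ∙ (y - 0))ᗮ.reflection :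
      EuclideanSpace ℝ (Fin k) →L[ℝ] EuclideanSpace ℝ (Fin k))).det
        = LinearMap.det ((ρ / dist y 0) ^ 2 • (ℝ ∙ (y - 0))ᗮ.reflection.toLinearMap) := rfl
    rw [h1, LinearMap.det_smul, Submodule.det_reflection, abs_mul, abs_neg_one_pow, mul_one,
      abs_pow, abs_pow, finrank_euclideanSpace_fin, dist_zero_right,
      abs_of_pos (by positivity), ← pow_mul]
  simp only [hdet, smul_eq_mul, ← hι, hnorm]
  unfold powKernel
  rw [hdist y hy0]
  have e1 : ρ * ‖y - e‖ / ‖y‖ = (ρ / ‖y‖) * ‖y - e‖ := by ring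
  have e2 : ‖y‖ / ρ = (ρ / ‖y‖)⁻¹ := by rw [inv_div]
  have hq : 0 < ρ / ‖y‖ := by positivity
  rw [e1, e2, Real.mul_rpow hq.le (norm_nonneg _), Real.inv_rpow hq.le, ← Real.rpow_neg hq.le,
    neg_neg]
  have e3 : (ρ / ‖y‖) ^ (2 * k) * (ρ / ‖y‖) ^ (-((k : ℝ) + 2 * s))
      = (ρ / ‖y‖) ^ ((k : ℝ) - 2 * s) := by
    rw [← Real.rpow_natCast, ← Real.rpow_add hq]
    push_cast
    ring_nf
  rw [← e3]
  ring

lemma one_add_pow_sub_one_le (k : ℕ) {t : ℝ} (ht : 0 ≤ t) (ht1 : t ≤ 1) :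
    (1 + t) ^ k - 1 ≤ (2 ^ k - 1) * t := by
  induction k with
  | zero => simp
  | succ n ih =>
    have h2 : (1 : ℝ) ≤ 2 ^ n := one_le_pow₀ (by norm_num)
    have h3 : (2 ^ n - 1) * t * t ≤ (2 ^ n - 1) * t :=
      mul_le_of_le_one_right (mul_nonneg (by linarith) ht) ht1
    have h4 := mul_le_mul_of_nonneg_right ih (by linarith : 0 ≤ 1 + t)
    rw [pow_succ, pow_succ]
    nlinarith

/-- The inversion moves a small ball around `e` only by a quantity of second order, so the shell by
which the cut-off fails to be invariant contributes `O(ε^{2-2s})`. -/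
lemma tendsto_shell (hs1 : s < 1) (hs0 : 0 < s) (he : e ≠ 0) (hf : DifferentiableAt ℝ f ‖e‖) :
    Tendsto (fun ε : ℝ => ∫ y in {y | ‖e‖ < ‖y‖ ∧ ε < ‖y - e‖ ∧ ‖e‖ * ‖y - e‖ / ‖y‖ ≤ ε},
      (f ‖y‖ - f ‖e‖) * powKernel (2 * s) (y - e)) (𝓝[>] 0) (𝓝 0) := by
  have hρ : 0 < ‖e‖ := norm_pos_iff.2 he
  set ρ := ‖e‖ with hρdef
  obtain ⟨L, hL, hb⟩ := hf.isBigO_sub.exists_nonneg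
  obtain ⟨η, hη, hb⟩ := Metric.eventually_nhds_iff.1 hb.bound
  set ω : ℝ := (volume : Measure (EuclideanSpace ℝ (Fin k))).real (Metric.ball 0 1) with hω
  set M : ℝ := 2 * L * (ω * ((2 ^ k - 1) * (2 / ρ))) with hM
  have hlim : Tendsto (fun ε : ℝ => M * ε ^ (2 - 2 * s)) (𝓝[>] 0) (𝓝 0) := by
    have : Tendsto (fun ε : ℝ => M * ε ^ (2 - 2 * s)) (𝓝 0) (𝓝 (M * 0 ^ (2 - 2 * s))) :=
      ((Real.continuousAt_rpow_const 0 (2 - 2 * s) (Or.inr (by linarith))).tendsto).const_mul M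
    rw [Real.zero_rpow (by linarith), mul_zero] at this
    exact this.mono_left nhdsWithin_le_nhds
  refine squeeze_zero_norm' ?_ hlim
  have hmin : 0 < min (ρ / 2) (η / 2) := lt_min (by linarith) (by linarith)
  filter_upwards [Ioo_mem_nhdsGT hmin] with ε hε
  have hε0 : 0 < ε := hε.1
  have hερ : ε < ρ / 2 := hε.2.trans_le (min_le_left _ _)
  have hεη : ε < η / 2 := hε.2.trans_le (min_le_right _ _)
  set T : Set (EuclideanSpace ℝ (Fin k)) :=
    {y | ρ < ‖y‖ ∧ ε < ‖y - e‖ ∧ ρ * ‖y - e‖ / ‖y‖ ≤ ε} with hT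
  set t := 2 * ε / ρ with ht
  have ht0 : 0 ≤ t := by positivity
  have ht1 : t ≤ 1 := by rw [ht, div_le_one hρ]; linarith
  have hT2 : ∀ y ∈ T, ‖y - e‖ ≤ 2 * ε ∧ ‖y - e‖ ≤ ε * (1 + t) := by
    rintro y ⟨h1, h2, h3⟩
    have hyp : 0 < ‖y‖ := hρ.trans h1
    rw [div_le_iff₀ hyp] at h3
    have h4 : ‖y‖ ≤ ρ + ‖y - e‖ := by
      have := norm_add_le e (y - e); rwa [add_sub_cancel] at this
    have h5 : ρ * ‖y - e‖ ≤ ε * (ρ + ‖y - e‖) := h3.trans (mul_le_mul_of_nonneg_left h4 hε0.le)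
    have h6 : ‖y - e‖ ≤ 2 * ε := by
      by_contra! hlt
      nlinarith
    refine ⟨h6, ?_⟩
    have h7 : ρ * ‖y - e‖ ≤ ρ * (ε * (1 + t)) := by
      have : ρ * (ε * (1 + t)) = ε * (ρ + 2 * ε) := by rw [ht]; field_simp
      rw [this]
      exact h5.trans (mul_le_mul_of_nonneg_left (by linarith) hε0.le)
    exact le_of_mul_le_mul_left h7 hρ
  have hsub : T ⊆ Metric.closedBall e (ε * (1 + t)) \ Metric.closedBall e ε := by
    intro y hy
    refine ⟨by simpa [dist_eq_norm] using (hT2 y hy).2, ?_⟩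
    simpa [dist_eq_norm] using hy.2.1
  have hfin : volume (Metric.closedBall e (ε * (1 + t)) \ Metric.closedBall e ε) ≠ ⊤ :=
    ((measure_mono sdiff_subset).trans_lt measure_closedBall_lt_top).ne
  have hvol : (volume : Measure (EuclideanSpace ℝ (Fin k))).real T
      ≤ ω * (ε ^ k * ((2 ^ k - 1) * t)) := by
    have hball : ∀ r : ℝ, 0 ≤ r →
        (volume : Measure (EuclideanSpace ℝ (Fin k))).real (Metric.closedBall e r) = r ^ k * ω := by
      intro r hr
      rw [Measure.real, Measure.addHaar_closedBall _ _ hr, ENNReal.toReal_mul,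
        ENNReal.toReal_ofReal (by positivity), finrank_euclideanSpace_fin]
      rfl
    have hle : ε ≤ ε * (1 + t) := le_mul_of_one_le_right hε0.le (by linarith)
    calc volume.real T ≤ volume.real (Metric.closedBall e (ε * (1 + t)) \ Metric.closedBall e ε) :=
          measureReal_mono hsub hfin
      _ = (ε * (1 + t)) ^ k * ω - ε ^ k * ω := by
          rw [measureReal_sdiff (Metric.closedBall_subset_closedBall hle)
            Metric.isClosed_closedBall.measurableSet measure_closedBall_lt_top.ne,
            hball _ (by positivity), hball _ hε0.le]
      _ = ω * (ε ^ k * ((1 + t) ^ k - 1)) := by rw [mul_pow]; ring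
      _ ≤ _ := by
          have := one_add_pow_sub_one_le k ht0 ht1
          have hω0 : 0 ≤ ω := measureReal_nonneg
          gcongr
  have hbound : ∀ y ∈ T, ‖(f ‖y‖ - f ρ) * powKernel (2 * s) (y - e)‖
      ≤ 2 * L * ε * ε ^ (-((k : ℝ) + 2 * s)) := by
    intro y hy
    rw [norm_mul, Real.norm_of_nonneg (powKernel_nonneg _ _)]
    have h1 : |‖y‖ - ρ| ≤ ‖y - e‖ := abs_norm_sub_norm_le y e
    have h2 := hb (y := ‖y‖) (by
      rw [Real.dist_eq]; linarith [(hT2 y hy).1])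
    refine mul_le_mul ?_ ?_ (powKernel_nonneg _ _) (by positivity)
    · refine h2.trans ?_
      rw [Real.norm_eq_abs]
      nlinarith [(hT2 y hy).1]
    · exact Real.rpow_le_rpow_of_nonpos hε0 hy.2.1.le (by linarith [Nat.cast_nonneg (α := ℝ) k])
  have hTfin : volume T < ⊤ := (measure_mono (hsub.trans sdiff_subset)).trans_lt
    measure_closedBall_lt_top
  calc ‖∫ y in T, (f ‖y‖ - f ρ) * powKernel (2 * s) (y - e)‖
      ≤ 2 * L * ε * ε ^ (-((k : ℝ) + 2 * s)) * volume.real T :=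
        norm_setIntegral_le_of_norm_le_const hTfin hbound
    _ ≤ 2 * L * ε * ε ^ (-((k : ℝ) + 2 * s)) * (ω * (ε ^ k * ((2 ^ k - 1) * t))) := by gcongr
    _ = M * ε ^ (2 - 2 * s) := by
        have e1 : ε ^ (2 - 2 * s) = ε ^ (-((k : ℝ) + 2 * s)) * ε ^ k * ε * ε := by
          rw [mul_assoc, ← sq, ← Real.rpow_natCast ε k, ← Real.rpow_natCast ε 2,
            ← Real.rpow_add hε0, ← Real.rpow_add hε0]
          push_cast
          ring_nf
        rw [e1, hM, ht]
        ring

/-- **Inversion formula** for the fractional Laplacian of a radial function at `e ≠ 0`: no principal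
value is left, since the increments at `r` and `|e|²/r` cancel to first order. -/
theorem symIntegral_radial (hk : 1 ≤ k) (hs : 1 / 2 < s) (hs1 : s < 1) (hks : 2 * s ≤ k)
    (hfm : Measurable f) (hB : ∀ r, |f r| ≤ B) (he : e ≠ 0) (hf : ContDiffAt ℝ 2 f ‖e‖) :
    symIntegral s (fun y => f ‖y‖) e = ∫ y in {y | ‖e‖ < ‖y‖},
      foldedIncrement ((k : ℝ) - 2 * s) f ‖e‖ ‖y‖ * powKernel (2 * s) (y - e) := by
  have := nontrivial_euclideanSpace hk
  have hρ : 0 < ‖e‖ := norm_pos_iff.2 he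
  set F : EuclideanSpace ℝ (Fin k) → ℝ := fun y => f ‖y‖ with hF
  have hFm : Measurable F := hfm.comp measurable_norm
  have hFB : ∀ y, |F y| ≤ B := fun y => hB _
  have hFe : ContDiffAt ℝ 2 F e := ContDiffAt.comp e hf (contDiffAt_norm ℝ he)
  have hi := integrable_symDiff hk hs hs1 hFm hFB hFe
  have hG := integrableOn_foldedIncrement hk hs hs1 (β := (k : ℝ) - 2 * s) (by linarith) hfm hB he hf
  set A : Set (EuclideanSpace ℝ (Fin k)) := {y | ‖e‖ < ‖y‖} with hA
  have hAm : MeasurableSet A := measurableSet_norm_gt _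
  set w : EuclideanSpace ℝ (Fin k) → ℝ := fun y => ‖e‖ * ‖y - e‖ / ‖y‖ with hw
  have hwm : Measurable w := by rw [hw]; fun_prop
  have lim1 : Tendsto (fun ε : ℝ => ∫ τ in {τ | ε < ‖τ‖}, symDiff F e τ * powKernel (2 * s) τ)
      (𝓝[>] 0) (𝓝 (symIntegral s F e)) := by
    have := tendsto_setIntegral_superlevel (μ := volume) (A := univ)
      (w := fun τ : EuclideanSpace ℝ (Fin k) => ‖τ‖) measurable_norm
      (by
        rw [Measure.restrict_univ]
        filter_upwards [compl_mem_ae_iff.2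
          (measure_singleton (0 : EuclideanSpace ℝ (Fin k)))] with y hy
        exact norm_pos_iff.2 hy) hi.integrableOn
    simpa [symIntegral] using this
  have lim2 := tendsto_setIntegral_superlevel (μ := volume) hwm
    (by
      filter_upwards [ae_restrict_mem hAm] with y hy
      have h1 : 0 < ‖y‖ := hρ.trans hy
      have h2 : 0 < ‖y - e‖ := norm_sub_pos_iff.2 fun h => by simp [hA, h] at hy
      exact div_pos (mul_pos hρ h2) h1) hG
  have lim3 := lim2.add (tendsto_shell (f := f) hs1 (by linarith) he
    (hf.differentiableAt (by norm_num)))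
  rw [add_zero] at lim3
  refine tendsto_nhds_unique lim1 (lim3.congr' ?_)
  filter_upwards [self_mem_nhdsWithin] with ε hε
  have hε0 : 0 < ε := hε
  have hio := integrableOn_diff hk (by linarith : 0 < s) hFm hFB e hε0
  rw [setIntegral_symDiff (neg_setOf_norm (ε < ·)) hio]
  -- substitute `y = e + τ`
  set g : EuclideanSpace ℝ (Fin k) → ℝ := fun y => (F y - F e) * powKernel (2 * s) (y - e) with hg
  set D : Set (EuclideanSpace ℝ (Fin k)) := {y | ε < ‖y - e‖} with hD
  have hDm : MeasurableSet D := measurableSet_lt measurable_const (by fun_prop)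
  have mp := measurePreserving_add_left (volume : Measure (EuclideanSpace ℝ (Fin k))) e
  have me := (MeasurableEquiv.addLeft e).measurableEmbedding
  have hpre : (fun τ => e + τ) ⁻¹' D = {τ | ε < ‖τ‖} := by ext τ; simp [hD]
  have htr : ∫ τ in {τ | ε < ‖τ‖}, (F (e + τ) - F e) * powKernel (2 * s) τ = ∫ y in D, g y := by
    rw [← hpre, ← mp.setIntegral_preimage_emb me g D]
    simp [hg]
  have hgi : IntegrableOn g D := by
    rw [← mp.integrableOn_comp_preimage me, hpre]
    refine hio.congr (Eventually.of_forall fun τ => ?_)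
    simp [hg]
  rw [htr]
  set Di : Set (EuclideanSpace ℝ (Fin k)) := {y | ‖y‖ < ‖e‖ ∧ ε < ‖y - e‖} with hDi
  set Do : Set (EuclideanSpace ℝ (Fin k)) := A ∩ {y | ε < w y} with hDo
  set Ds : Set (EuclideanSpace ℝ (Fin k)) :=
    {y | ‖e‖ < ‖y‖ ∧ ε < ‖y - e‖ ∧ ‖e‖ * ‖y - e‖ / ‖y‖ ≤ ε} with hDs
  have hwlt : ∀ y ∈ A, w y ≤ ‖y - e‖ := fun y hy => by
    have h1 : 0 < ‖y‖ := hρ.trans hy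
    rw [hw, div_le_iff₀ h1, mul_comm]
    exact mul_le_mul_of_nonneg_left (le_of_lt hy) (norm_nonneg _)
  have hDim : MeasurableSet Di :=
    (measurableSet_lt measurable_norm measurable_const).inter hDm
  have hDom : MeasurableSet Do := hAm.inter (measurableSet_lt measurable_const hwm)
  have hDsm : MeasurableSet Ds :=
    hAm.inter (hDm.inter (measurableSet_le hwm measurable_const))
  have hDiD : Di ⊆ D := fun y hy => hy.2
  have hDoD : Do ⊆ D := fun y hy => lt_of_lt_of_le hy.2 (hwlt y hy.1)
  have hDsD : Ds ⊆ D := fun y hy => hy.2.1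
  have hdis1 : Disjoint Do Ds := disjoint_left.2 fun y h1 h2 => absurd h2.2.2 (not_le.2 h1.2)
  have hdis2 : Disjoint (Do ∪ Ds) Di := disjoint_left.2 fun y h1 h2 => by
    rcases h1 with h1 | h1
    · exact lt_asymm h2.1 h1.1
    · exact lt_asymm h2.1 h1.1
  have hsplit : ∫ y in D, g y = (∫ y in Do, g y) + (∫ y in Ds, g y) + ∫ y in Di, g y := by
    rw [← setIntegral_union hdis1 hDsm (hgi.mono_set hDoD) (hgi.mono_set hDsD),
      ← setIntegral_union hdis2 hDim (hgi.mono_set (union_subset hDoD hDsD)) (hgi.mono_set hDiD)]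
    -- on the sphere `|y| = |e|` itself the integrand vanishes
    refine setIntegral_eq_of_subset_of_forall_sdiff_eq_zero hDm
      (union_subset (union_subset hDoD hDsD) hDiD) fun y hy => ?_
    have hye : ‖y‖ = ‖e‖ := by
      by_contra hne
      refine hy.2 ?_
      rcases lt_or_gt_of_ne hne with h | h
      · exact Or.inr ⟨h, hy.1⟩
      · rcases lt_or_ge ε (w y) with h2 | h2
        · exact Or.inl (Or.inl ⟨h, h2⟩)
        · exact Or.inl (Or.inr ⟨h, hy.1, h2⟩)
    simp [hg, hF, hye]
  have hinv : ∫ y in Di, g y = ∫ y in Do, (f (‖e‖ ^ 2 / ‖y‖) - f ‖e‖)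
      * (‖y‖ / ‖e‖) ^ (-((k : ℝ) - 2 * s)) * powKernel (2 * s) (y - e) :=
    setIntegral_inversion hk s f he ε
  have hsum : ∫ y in Do, foldedIncrement ((k : ℝ) - 2 * s) f ‖e‖ ‖y‖ * powKernel (2 * s) (y - e)
      = (∫ y in Do, g y) + ∫ y in Di, g y := by
    have hGo := hG.mono_set (inter_subset_left : Do ⊆ A)
    have hgo := hgi.mono_set hDoD
    have hrest : ∀ y, (f (‖e‖ ^ 2 / ‖y‖) - f ‖e‖)
        * (‖y‖ / ‖e‖) ^ (-((k : ℝ) - 2 * s)) * powKernel (2 * s) (y - e)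
        = foldedIncrement ((k : ℝ) - 2 * s) f ‖e‖ ‖y‖ * powKernel (2 * s) (y - e) - g y := by
      intro y; simp only [foldedIncrement, hg, hF]; ring
    rw [hinv]
    simp_rw [hrest]
    rw [integral_sub hGo hgo]
    ring
  rw [hsum, hsplit]
  ring

end Inversion

/-! ### Frames -/

section Frame

variable {N k : ℕ} {ξ : Fin k → EuclideanSpace ℝ (Fin N)}

lemma framePoint_add (ξ : Fin k → EuclideanSpace ℝ (Fin N)) (τ σ : EuclideanSpace ℝ (Fin k)) :
    framePoint ξ (τ + σ) = framePoint ξ τ + framePoint ξ σ := by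
  simp [framePoint, add_smul, Finset.sum_add_distrib]

lemma framePoint_neg (ξ : Fin k → EuclideanSpace ℝ (Fin N)) (τ : EuclideanSpace ℝ (Fin k)) :
    framePoint ξ (-τ) = -framePoint ξ τ := by
  simp [framePoint]

lemma framePoint_zero (ξ : Fin k → EuclideanSpace ℝ (Fin N)) : framePoint ξ 0 = 0 := by
  simp [framePoint]

lemma contDiff_framePoint (ξ : Fin k → EuclideanSpace ℝ (Fin N)) :
    ContDiff ℝ 2 (framePoint ξ) := by
  unfold framePoint; fun_prop

lemma norm_framePoint (hξ : Orthonormal ℝ ξ) (τ : EuclideanSpace ℝ (Fin k)) :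
    ‖framePoint ξ τ‖ = ‖τ‖ := by
  have h : ‖framePoint ξ τ‖ ^ 2 = ‖τ‖ ^ 2 := by
    rw [← real_inner_self_eq_norm_sq, framePoint, hξ.inner_sum, EuclideanSpace.norm_sq_eq]
    simp [sq]
  exact (pow_left_inj₀ (norm_nonneg _) (norm_nonneg _) two_ne_zero).1 h

/-- Pythagoras on the affine plane through `x` spanned by a frame. -/
lemma exists_norm_sq_add_framePoint (hξ : Orthonormal ℝ ξ) (x : EuclideanSpace ℝ (Fin N)) :
    ∃ (e : EuclideanSpace ℝ (Fin k)) (a : ℝ), ∀ τ,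
      ‖x + framePoint ξ τ‖ ^ 2 = a ^ 2 + ‖e + τ‖ ^ 2 := by
  set e : EuclideanSpace ℝ (Fin k) := WithLp.toLp 2 fun i => inner ℝ (ξ i) x with he
  refine ⟨e, ‖x - framePoint ξ e‖, fun τ => ?_⟩
  have h1 : ∀ σ, inner ℝ (x - framePoint ξ e) (framePoint ξ σ) = 0 := by
    intro σ
    rw [framePoint, framePoint, inner_sum]
    refine Finset.sum_eq_zero fun i _ => ?_
    rw [inner_smul_right, inner_sub_left, real_inner_comm, real_inner_comm (ξ i),
      hξ.inner_right_fintype]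
    simp [he]
  have h2 : x + framePoint ξ τ = (x - framePoint ξ e) + framePoint ξ (e + τ) := by
    rw [framePoint_add]; abel
  rw [h2, norm_add_sq_real, h1, norm_framePoint hξ]
  ring

/-- Every vector lies in the span of some orthonormal `k`-frame, obtained from the standard one by a
reflection. -/
lemma exists_framePoint_eq (hk : 1 ≤ k) (hkN : k ≤ N) (x : EuclideanSpace ℝ (Fin N)) :
    ∃ ξ : Fin k → EuclideanSpace ℝ (Fin N), Orthonormal ℝ ξ ∧ ∃ e, framePoint ξ e = x := by
  set b := EuclideanSpace.basisFun (Fin N) ℝ with hb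
  set v := ‖x‖ • b (Fin.castLE hkN ⟨0, hk⟩) with hv
  have hnorm : ‖v‖ = ‖x‖ := by rw [hv, norm_smul, b.norm_eq_one, norm_norm, mul_one]
  set T := (ℝ ∙ (v - x))ᗮ.reflection with hT
  have hTv : T v = x := Submodule.reflection_sub hnorm
  refine ⟨fun i => T (b (Fin.castLE hkN i)), ?_, EuclideanSpace.single ⟨0, hk⟩ ‖x‖, ?_⟩
  · have h1 : Orthonormal ℝ (b ∘ Fin.castLE hkN) :=
      b.orthonormal.comp _ (Fin.castLE_injective hkN)
    exact h1.comp_linearIsometryEquiv T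
  · rw [framePoint, Finset.sum_eq_single ⟨0, hk⟩]
    · conv_rhs => rw [← hTv, hv, map_smul]
      simp
    · intro i _ hi; simp [hi]
    · simp

end Frame

/-! ### Supersolutions and contact points -/

section Contact

variable {N k : ℕ} {s p : ℝ} {u : EuclideanSpace ℝ (Fin N) → ℝ}

lemma IsViscositySupersolution.evaluation_le (hu : IsViscositySupersolution k s p u)
    {x : EuclideanSpace ℝ (Fin N)} {δ : ℝ} {φ : EuclideanSpace ℝ (Fin N) → ℝ} (hδ : 0 < δ)
    (hφ : ContDiffOn ℝ 2 φ (Metric.ball x δ))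
    (hmin : IsMinOn (fun y => u y - φ y) (Metric.ball x δ) x)
    {ξ : Fin k → EuclideanSpace ℝ (Fin N)} (hξ : Orthonormal ℝ ξ) :
    innerPart s ξ φ x δ + outerPart s ξ u x δ + ((u x ^ p : ℝ) : EReal) ≤ 0 := by
  refine le_trans (add_le_add_left ?_ _) (hu.2 x δ φ hδ hφ hmin)
  exact le_iSup (fun ξ : {ξ : Fin k → EuclideanSpace ℝ (Fin N) // Orthonormal ℝ ξ} =>
    innerPart s ξ.1 φ x δ + outerPart s ξ.1 u x δ) ⟨ξ, hξ⟩

/-- Strong maximum principle: a supersolution that vanishes at one point vanishes identically. -/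
lemma IsViscositySupersolution.pos (hk : 1 ≤ k) (hkN : k ≤ N) (hs : 0 < s) (hs1 : s < 1)
    (h0 : ∀ x, 0 ≤ u x) (hne : ∃ x, u x ≠ 0) (hu : IsViscositySupersolution k s p u)
    (x : EuclideanSpace ℝ (Fin N)) : 0 < u x := by
  by_contra! hx
  have hx0 : u x = 0 := le_antisymm hx (h0 x)
  obtain ⟨z, hz⟩ := hne
  have hzp : 0 < u z := lt_of_le_of_ne (h0 z) (Ne.symm hz)
  obtain ⟨ξ, hξ, e, he⟩ := exists_framePoint_eq hk hkN (z - x)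
  have he0 : 0 < ‖e‖ := by
    rw [← norm_framePoint hξ, he, norm_sub_pos_iff]
    rintro rfl
    exact hz hx0
  have hδ : 0 < ‖e‖ / 2 := by linarith
  have key := hu.evaluation_le (x := x) (φ := fun _ => 0) hδ contDiffOn_const
    (fun y _ => by simpa [hx0] using h0 y) hξ
  have hc := normConst_pos k hs hs1
  have hin : innerPart s ξ (fun _ : EuclideanSpace ℝ (Fin N) => (0 : ℝ)) x (‖e‖ / 2) = 0 := by
    simp [innerPart, extIntegral]
  have hnn : ∀ τ, 0 ≤ (u (x + framePoint ξ τ) - u x) * kernel k s τ := fun τ => by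
    rw [hx0, sub_zero, kernel_eq]
    exact mul_nonneg (h0 _) (mul_nonneg hc.le (powKernel_nonneg _ _))
  rw [hin, zero_add, outerPart, extIntegral_of_nonneg hnn] at key
  have hpw : (0 : EReal) ≤ ((u x ^ p : ℝ) : EReal) := by
    exact_mod_cast Real.rpow_nonneg (h0 x) p
  have hI : ∫⁻ τ in {τ : EuclideanSpace ℝ (Fin k) | ‖e‖ / 2 ≤ ‖τ‖},
      ENNReal.ofReal ((u (x + framePoint ξ τ) - u x) * kernel k s τ) = 0 := by
    have h1 := (le_add_of_nonneg_right hpw).trans key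
    have h2 : ∫⁻ τ in {τ : EuclideanSpace ℝ (Fin k) | ‖e‖ / 2 ≤ ‖τ‖},
      ENNReal.ofReal ((u (x + framePoint ξ τ) - u x) * kernel k s τ) ≤ 0 := by
      exact_mod_cast h1
    exact le_antisymm h2 zero_le
  -- near `e` the integrand is positive, by lower semicontinuity
  have hopen : IsOpen {y | 0 < u y} := hu.1.isOpen_preimage 0
  set O : Set (EuclideanSpace ℝ (Fin k)) :=
    {τ | ‖e‖ / 2 < ‖τ‖} ∩ (fun τ => x + framePoint ξ τ) ⁻¹' {y | 0 < u y} with hO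
  have hOo : IsOpen O := (isOpen_lt continuous_const continuous_norm).inter
    (hopen.preimage (continuous_const.add (contDiff_framePoint ξ).continuous))
  have heO : e ∈ O := by
    refine ⟨by simp only [mem_ofPred_eq]; linarith, ?_⟩
    simpa [he] using hzp
  have hOpos := hOo.measure_pos (volume : Measure (EuclideanSpace ℝ (Fin k))) ⟨e, heO⟩
  have hmeas : Measurable fun τ : EuclideanSpace ℝ (Fin k) =>
      ENNReal.ofReal ((u (x + framePoint ξ τ) - u x) * kernel k s τ) := by
    have h1 : Measurable u := hu.1.measurable
    have h2 : Measurable (framePoint ξ) := (contDiff_framePoint ξ).continuous.measurable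
    have h3 : Measurable (kernel k s) := (measurable_powKernel (2 * s)).const_mul _
    fun_prop
  rw [lintegral_eq_zero_iff hmeas] at hI
  have hsub : O ⊆ {τ | ‖e‖ / 2 ≤ ‖τ‖} := fun τ hτ => (show ‖e‖ / 2 < ‖τ‖ from hτ.1).le
  have hI2 := ae_restrict_of_ae_restrict_of_subset hsub hI
  rw [ae_restrict_iff' hOo.measurableSet] at hI2
  refine hOpos.ne' (measure_mono_null (fun τ hτ => ?_) hI2)
  simp only [Pi.zero_apply, mem_compl_iff, mem_ofPred_eq]
  intro h
  have h1 := h hτ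
  rw [ENNReal.ofReal_eq_zero, hx0, sub_zero] at h1
  have h2 : 0 < u (x + framePoint ξ τ) := hτ.2
  have h3 : 0 < kernel k s τ := mul_pos hc (Real.rpow_pos_of_pos (hδ.trans hτ.1) _)
  exact absurd h1 (not_le.2 (mul_pos h2 h3))

lemma symIntegral_comp_add (s : ℝ) (F : EuclideanSpace ℝ (Fin k) → ℝ)
    (e : EuclideanSpace ℝ (Fin k)) :
    symIntegral s (fun τ => F (e + τ)) 0 = symIntegral s F e := by
  simp [symIntegral, symDiff, sub_eq_add_neg]

/-- At a global contact point with a bounded test function, the operator along any frame applied to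
the test function itself obeys the inequality. -/
lemma IsViscositySupersolution.contact (hk : 1 ≤ k) (hs : 1 / 2 < s) (hs1 : s < 1)
    (hu : IsViscositySupersolution k s p u) {x : EuclideanSpace ℝ (Fin N)} {δ B : ℝ}
    {φ : EuclideanSpace ℝ (Fin N) → ℝ} (hδ : 0 < δ) (hφm : Measurable φ) (hB : ∀ y, |φ y| ≤ B)
    (hφ : ContDiffOn ℝ 2 φ (Metric.ball x δ)) (hmin : ∀ y, φ y - φ x ≤ u y - u x)
    {ξ : Fin k → EuclideanSpace ℝ (Fin N)} (hξ : Orthonormal ℝ ξ) :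
    normConst k s * symIntegral s (fun τ => φ (x + framePoint ξ τ)) 0 + u x ^ p ≤ 0 := by
  have hF : ContDiffAt ℝ 2 (fun τ => φ (x + framePoint ξ τ)) 0 := by
    refine ContDiffAt.comp (0 : EuclideanSpace ℝ (Fin k)) (g := φ) ?_
      (contDiffAt_const.add (contDiff_framePoint ξ).contDiffAt)
    rw [framePoint_zero, add_zero]
    exact hφ.contDiffAt (Metric.ball_mem_nhds x hδ)
  have hFm : Measurable (fun τ => φ (x + framePoint ξ τ)) :=
    hφm.comp ((contDiff_framePoint ξ).continuous.measurable.const_add x)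
  have h1 := symIntegral_le_evaluation (u := u) (φ := φ) (x := x) (ξ := ξ) hk hs hs1 hFm
    (fun y => hB _) hF hδ
    (fun τ _ => le_of_eq (by simp [symDiff, framePoint_neg, framePoint_zero, sub_eq_add_neg]))
    (fun τ _ => by simpa [framePoint_zero] using hmin (x + framePoint ξ τ))
  have h2 := hu.evaluation_le hδ hφ (fun y _ => by
    have := hmin y
    simp only [mem_ofPred_eq]
    linarith) hξ
  have h3 := (add_le_add_left h1 _).trans h2
  exact_mod_cast h3

/-- Contact with a radial function: choosing a frame whose span contains the contact point reduces
the inequality to one for a radial function on `ℝ^k`. -/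
lemma IsViscositySupersolution.contact_radial (hk : 1 ≤ k) (hkN : k ≤ N) (hs : 1 / 2 < s)
    (hs1 : s < 1) (hu : IsViscositySupersolution k s p u) {x : EuclideanSpace ℝ (Fin N)} {δ B : ℝ}
    {f : ℝ → ℝ} (hδ : 0 < δ) (hfm : Measurable f) (hB : ∀ r, |f r| ≤ B)
    (hf : ContDiffOn ℝ 2 (fun y : EuclideanSpace ℝ (Fin N) => f ‖y‖) (Metric.ball x δ))
    (hmin : ∀ y, f ‖y‖ - f ‖x‖ ≤ u y - u x) :
    ∃ e : EuclideanSpace ℝ (Fin k), ‖e‖ = ‖x‖ ∧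
      normConst k s * symIntegral s (fun τ => f ‖τ‖) e + u x ^ p ≤ 0 := by
  obtain ⟨ξ, hξ, e, he⟩ := exists_framePoint_eq hk hkN x
  refine ⟨e, by rw [← norm_framePoint hξ, he], ?_⟩
  have h := hu.contact hk hs hs1 hδ (hfm.comp measurable_norm) (fun y => hB _) hf hmin hξ
  have e1 : (fun τ => (f ∘ norm) (x + framePoint ξ τ))
      = fun τ => (fun σ : EuclideanSpace ℝ (Fin k) => f ‖σ‖) (e + τ) := by
    ext τ
    simp only [Function.comp_apply]
    rw [← norm_framePoint hξ, framePoint_add, he]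
  have e2 := symIntegral_comp_add s (fun σ : EuclideanSpace ℝ (Fin k) => f ‖σ‖) e
  rw [← e1] at e2
  rw [← e2]
  exact h

/-- If off a compact set `u - w` is at least its value at some point of that set, then `u - w` attains
its global minimum. -/
lemma exists_contact_of_isCompact (hu : LowerSemicontinuous u)
    {w : EuclideanSpace ℝ (Fin N) → ℝ} {K : Set (EuclideanSpace ℝ (Fin N))} (hK : IsCompact K)
    (hw : ContinuousOn w K) {z : EuclideanSpace ℝ (Fin N)} (hz : z ∈ K)
    (hout : ∀ y, y ∉ K → u z - w z ≤ u y - w y) :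
    ∃ x ∈ K, u x - w x ≤ u z - w z ∧ ∀ y, w y - w x ≤ u y - u x := by
  have hl : LowerSemicontinuousOn (fun y => u y + -w y) K :=
    (hu.lowerSemicontinuousOn K).add hw.neg.lowerSemicontinuousOn
  obtain ⟨x, hxK, hx⟩ := hl.exists_isMinOn ⟨z, hz⟩ hK
  have h1 : u x + -w x ≤ u z + -w z := hx hz
  refine ⟨x, hxK, by linarith, fun y => ?_⟩
  by_cases hy : y ∈ K
  · have h2 : u x + -w x ≤ u y + -w y := hx hy
    linarith
  · linarith [hout y hy]

/-- If a radial function vanishing at infinity lies below `u` near the origin but not everywhere,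
then it touches `u` from below, up to an additive constant, at a point where it exceeds `u`. -/
lemma exists_contact_radial (hu : LowerSemicontinuous u) (h0 : ∀ x, 0 ≤ u x) {f : ℝ → ℝ} {r₀ : ℝ}
    (hf : ContinuousOn f (Ici r₀)) (hlim : Tendsto f atTop (𝓝 0))
    (hin : ∀ y, ‖y‖ < r₀ → f ‖y‖ ≤ u y) {z : EuclideanSpace ℝ (Fin N)} (hz : u z < f ‖z‖) :
    ∃ x, r₀ ≤ ‖x‖ ∧ u x < f ‖x‖ ∧ ∀ y, f ‖y‖ - f ‖x‖ ≤ u y - u x := by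
  obtain ⟨R, hR⟩ := eventually_atTop.1
    (hlim.eventually (gt_mem_nhds (sub_pos.2 hz)))
  set K : Set (EuclideanSpace ℝ (Fin N)) :=
    Metric.closedBall 0 (max R ‖z‖) ∩ {y | r₀ ≤ ‖y‖} with hK
  have hKc : IsCompact K := (isCompact_closedBall _ _).inter_right
    (isClosed_le continuous_const continuous_norm)
  have hzK : z ∈ K := by
    refine ⟨by simp, ?_⟩
    by_contra hlt
    exact absurd (hin z (not_le.1 hlt)) (not_le.2 hz)
  obtain ⟨x, hx, h1, h2⟩ := exists_contact_of_isCompact (w := fun y => f ‖y‖) hu hKc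
    (hf.comp continuous_norm.continuousOn fun y hy => hy.2) hzK fun y hy => by
      rcases lt_or_ge ‖y‖ r₀ with h | h
      · linarith [hin y h]
      · have hgt : max R ‖z‖ < ‖y‖ := by
          by_contra hle
          exact hy ⟨by simpa using not_lt.1 hle, h⟩
        linarith [hR ‖y‖ ((le_max_left _ _).trans hgt.le), h0 y]
  exact ⟨x, hx.2, by linarith, h2⟩

end Contact

/-! ### Decay of the minima of a supersolution -/

section Decay

variable {N k : ℕ} {s p : ℝ} {u : EuclideanSpace ℝ (Fin N) → ℝ}

lemma symIntegral_const_mul (s c : ℝ) (F : EuclideanSpace ℝ (Fin k) → ℝ)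
    (e : EuclideanSpace ℝ (Fin k)) :
    symIntegral s (fun y => c * F y) e = c * symIntegral s F e := by
  rw [symIntegral, symIntegral, ← integral_const_mul]
  congr 1; ext τ; unfold symDiff; ring

lemma integral_cutWeight_nonneg (k : ℕ) (s : ℝ) :
    0 ≤ ∫ τ : EuclideanSpace ℝ (Fin k), cutWeight s ‖τ‖ * powKernel (2 * s) τ :=
  integral_nonneg fun _ => mul_nonneg (cutWeight_nonneg (norm_nonneg _)) (powKernel_nonneg _ _)

/-- The truncated paraboloid `max (1 - |y|²/(4R²), 0)`. -/
def paraboloid {N : ℕ} (R : ℝ) (y : EuclideanSpace ℝ (Fin N)) : ℝ :=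
  max (1 - ‖y‖ ^ 2 / (4 * R ^ 2)) 0

lemma paraboloid_nonneg (R : ℝ) (y : EuclideanSpace ℝ (Fin N)) : 0 ≤ paraboloid R y :=
  le_max_right _ _

lemma paraboloid_le_one (R : ℝ) (y : EuclideanSpace ℝ (Fin N)) : paraboloid R y ≤ 1 :=
  max_le (sub_le_self _ (by positivity)) zero_le_one

lemma continuous_paraboloid (R : ℝ) :
    Continuous (paraboloid R : EuclideanSpace ℝ (Fin N) → ℝ) := by
  unfold paraboloid; fun_prop

lemma paraboloid_of_norm_le {R : ℝ} (hR : 0 < R) {y : EuclideanSpace ℝ (Fin N)}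
    (hy : ‖y‖ ≤ 2 * R) : paraboloid R y = 1 - ‖y‖ ^ 2 / (4 * R ^ 2) := by
  refine max_eq_left (sub_nonneg.2 ((div_le_one (by positivity)).2 ?_))
  have := pow_le_pow_left₀ (norm_nonneg y) hy 2
  linarith [this, mul_pow 2 R 2]

lemma paraboloid_eq_zero {R : ℝ} (hR : 0 < R) {y : EuclideanSpace ℝ (Fin N)}
    (hy : 2 * R ≤ ‖y‖) : paraboloid R y = 0 := by
  refine max_eq_right (sub_nonpos.2 ((one_le_div (by positivity)).2 ?_))
  have := pow_le_pow_left₀ (by linarith) hy 2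
  linarith [this, mul_pow 2 R 2]

lemma neg_cutWeight_le_paraboloid (hs : 0 < s) (hs1 : s < 1) {R : ℝ} (hR : 0 < R)
    {x : EuclideanSpace ℝ (Fin N)} (hx : ‖x‖ ≤ 2 * R) (v : EuclideanSpace ℝ (Fin N)) :
    -cutWeight s (‖v‖ / R)
      ≤ (paraboloid R (x + v) + paraboloid R (x - v) - 2 * paraboloid R x) / 2 := by
  rcases le_or_gt ‖v‖ R with hv | hv
  · rw [cutWeight_of_le_one (by linarith) (by positivity) ((div_le_one hR).2 hv) hs.ne',
      paraboloid_of_norm_le hR hx]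
    have h1 : 1 - ‖x + v‖ ^ 2 / (4 * R ^ 2) ≤ paraboloid R (x + v) := le_max_left _ _
    have h2 : 1 - ‖x - v‖ ^ 2 / (4 * R ^ 2) ≤ paraboloid R (x - v) := le_max_left _ _
    have h3 : ‖x + v‖ ^ 2 + ‖x - v‖ ^ 2 = 2 * ‖x‖ ^ 2 + 2 * ‖v‖ ^ 2 := by
      have := parallelogram_law_with_norm ℝ x v
      nlinarith [this]
    have h4 : ‖x + v‖ ^ 2 / (4 * R ^ 2) + ‖x - v‖ ^ 2 / (4 * R ^ 2)
        = 2 * (‖x‖ ^ 2 / (4 * R ^ 2)) + (‖v‖ / R) ^ 2 / 2 := by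
      rw [← add_div, h3]; field_simp; ring
    have h5 : 0 ≤ (‖v‖ / R) ^ 2 := by positivity
    linarith
  · have h1 := one_le_cutWeight hs.le ((one_le_div hR).2 hv.le)
    linarith [paraboloid_nonneg R (x + v), paraboloid_nonneg R (x - v), paraboloid_le_one R x]

/-- Touching a supersolution from below by a paraboloid of width `R` and height comparable with
`u z` produces a point where `u^p` is controlled by `u z` on the scale `R`. -/
lemma IsViscositySupersolution.exists_rpow_le (hk : 1 ≤ k) (hkN : k ≤ N) (hs : 1 / 2 < s)
    (hs1 : s < 1) (hpos : ∀ x, 0 < u x) (hu : IsViscositySupersolution k s p u) :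
    ∃ C, 0 ≤ C ∧ ∀ R, 0 < R → ∀ z, ‖z‖ ≤ R →
      ∃ x, ‖x‖ ≤ 2 * R ∧ u x ≤ 2 * u z ∧ u x ^ p ≤ C * u z * R ^ (-(2 * s)) := by
  set c := ∫ τ : EuclideanSpace ℝ (Fin k), cutWeight s ‖τ‖ * powKernel (2 * s) τ with hc
  have hc0 : 0 ≤ c := integral_cutWeight_nonneg k s
  have hn := normConst_pos k (by linarith : 0 < s) hs1
  refine ⟨normConst k s * 2 * c, by positivity, fun R hR z hz => ?_⟩
  set a := 2 * u z with ha
  have ha0 : 0 < a := mul_pos two_pos (hpos z)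
  set φ : EuclideanSpace ℝ (Fin N) → ℝ := fun y => a * paraboloid R y with hφ
  have hφc : Continuous φ := continuous_const.mul (continuous_paraboloid R)
  have hφz : 3 / 2 * u z ≤ φ z := by
    have h1 : 3 / 4 ≤ paraboloid R z := by
      rw [paraboloid_of_norm_le hR (by linarith)]
      have h2 : ‖z‖ ^ 2 / (4 * R ^ 2) ≤ 1 / 4 := by
        rw [div_le_div_iff₀ (by positivity) (by norm_num)]
        have := pow_le_pow_left₀ (norm_nonneg z) hz 2
        linarith
      linarith
    have := mul_le_mul_of_nonneg_left h1 ha0.le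
    simp only [hφ]
    linarith
  obtain ⟨x, hxK, hx1, hx2⟩ := exists_contact_of_isCompact hu.1
    (isCompact_closedBall (0 : EuclideanSpace ℝ (Fin N)) (2 * R)) hφc.continuousOn
    (z := z) (by simpa using (by linarith : ‖z‖ ≤ 2 * R)) fun y hy => by
      have h1 : φ y = 0 := by
        simp only [hφ]
        rw [paraboloid_eq_zero hR (by simpa using (not_le.1 (by simpa using hy)).le), mul_zero]
      linarith [hpos y, hpos z]
  have hxn : ‖x‖ ≤ 2 * R := by simpa using hxK
  have hux : u x < φ x := by linarith [hpos z]
  have hxa : φ x ≤ a := by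
    simpa [hφ] using mul_le_mul_of_nonneg_left (paraboloid_le_one R x) ha0.le
  have hxlt : ‖x‖ < 2 * R := by
    refine lt_of_le_of_ne hxn fun h => ?_
    have : φ x = 0 := by simp only [hφ]; rw [paraboloid_eq_zero hR h.ge, mul_zero]
    linarith [hpos x]
  have hδ : 0 < 2 * R - ‖x‖ := by linarith
  have hsm : ContDiffOn ℝ 2 φ (Metric.ball x (2 * R - ‖x‖)) := by
    have h1 : ContDiff ℝ 2 fun y : EuclideanSpace ℝ (Fin N) => a * (1 - ‖y‖ ^ 2 / (4 * R ^ 2)) :=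
      contDiff_const.mul (contDiff_const.sub ((contDiff_norm_sq ℝ).div_const _))
    refine h1.contDiffOn.congr fun y hy => ?_
    have h2 : ‖y - x‖ < 2 * R - ‖x‖ := by simpa [dist_eq_norm] using hy
    have h3 : ‖y‖ ≤ 2 * R := by
      have := norm_add_le (y - x) x
      rw [sub_add_cancel] at this
      linarith
    simp only [hφ]
    rw [paraboloid_of_norm_le hR h3]
  obtain ⟨ξ, hξ, -⟩ := exists_framePoint_eq hk hkN (0 : EuclideanSpace ℝ (Fin N))
  have hB : ∀ y, |φ y| ≤ a := fun y => by
    rw [abs_of_nonneg (mul_nonneg ha0.le (paraboloid_nonneg R y))]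
    simpa [hφ] using mul_le_mul_of_nonneg_left (paraboloid_le_one R y) ha0.le
  have key := hu.contact hk hs hs1 hδ hφc.measurable hB hsm hx2 hξ
  have hF : ContDiffAt ℝ 2 (fun τ => φ (x + framePoint ξ τ)) 0 := by
    refine ContDiffAt.comp (0 : EuclideanSpace ℝ (Fin k)) (g := φ) ?_
      (contDiffAt_const.add (contDiff_framePoint ξ).contDiffAt)
    rw [framePoint_zero, add_zero]
    exact hsm.contDiffAt (Metric.ball_mem_nhds x hδ)
  have hFm : Measurable (fun τ => φ (x + framePoint ξ τ)) :=
    hφc.measurable.comp ((contDiff_framePoint ξ).continuous.measurable.const_add x)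
  have hlow : -a * (R ^ (-(2 * s)) * c) ≤ symIntegral s (fun τ => φ (x + framePoint ξ τ)) 0 := by
    rw [hc, ← integral_cutWeight k s hR, ← integral_const_mul, symIntegral]
    refine integral_mono ((integrable_cutWeight hk hs hs1 hR).const_mul _)
      (integrable_symDiff hk hs hs1 hFm (fun y => hB _) hF) fun τ => ?_
    rw [← mul_assoc]
    refine mul_le_mul_of_nonneg_right ?_ (powKernel_nonneg _ _)
    have h1 := neg_cutWeight_le_paraboloid (by linarith : 0 < s) hs1 hR hxn (framePoint ξ τ)
    rw [norm_framePoint hξ] at h1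
    have h2 := mul_le_mul_of_nonneg_left h1 ha0.le
    simp only [symDiff, hφ, zero_add, zero_sub, framePoint_neg, framePoint_zero, add_zero,
      ← sub_eq_add_neg]
    linarith
  refine ⟨x, hxn, by linarith, ?_⟩
  have h3 := mul_le_mul_of_nonneg_left hlow hn.le
  have h4 : normConst k s * (-a * (R ^ (-(2 * s)) * c))
      = -(normConst k s * 2 * c * u z * R ^ (-(2 * s))) := by rw [ha]; ring
  linarith

end Decay

/-! ### Barriers from below -/

section Barrier

variable {k : ℕ} {s M : ℝ} {e : EuclideanSpace ℝ (Fin k)}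

/-- The fundamental solution `r^{-β}` outside the unit ball, with the constant `M` inside. -/
def cappedPower (β M r : ℝ) : ℝ := if r < 1 then M else r ^ (-β)

lemma cappedPower_of_one_le {β M r : ℝ} (hr : 1 ≤ r) : cappedPower β M r = r ^ (-β) :=
  if_neg (not_lt.2 hr)

lemma abs_cappedPower_le {β M : ℝ} (hβ : 0 ≤ β) (hM : 1 ≤ M) (r : ℝ) :
    |cappedPower β M r| ≤ M := by
  unfold cappedPower
  split_ifs with h
  · rw [abs_of_nonneg (by linarith)]
  · have h1 : 1 ≤ r := not_lt.1 h
    rw [abs_of_nonneg (Real.rpow_nonneg (by linarith) _)]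
    exact (Real.rpow_le_one_of_one_le_of_nonpos h1 (by linarith)).trans hM

lemma measurable_cappedPower (β M : ℝ) : Measurable (cappedPower β M) :=
  Measurable.ite measurableSet_Iio measurable_const (by fun_prop)

lemma eventuallyEq_cappedPower {β M r : ℝ} (hr : 1 < r) :
    cappedPower β M =ᶠ[𝓝 r] fun r => r ^ (-β) := by
  filter_upwards [lt_mem_nhds hr] with t ht
  exact cappedPower_of_one_le (le_of_lt ht)

lemma contDiffAt_cappedPower {β M r : ℝ} (hr : 1 < r) :
    ContDiffAt ℝ 2 (cappedPower β M) r :=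
  (contDiffAt_id.rpow_const_of_ne (by simp; linarith)).congr_of_eventuallyEq
    (eventuallyEq_cappedPower hr)

lemma foldedIncrement_cappedPower {β M ρ r : ℝ} (hρ : 1 ≤ ρ) (hr : ρ < r) :
    foldedIncrement β (cappedPower β M) ρ r
      = if ρ ^ 2 < r then M * ρ ^ β * r ^ (-β) - ρ ^ (-β) else 0 := by
  have hρ0 : 0 < ρ := by linarith
  have hr0 : 0 < r := hρ0.trans hr
  have e1 : (r / ρ) ^ (-β) = r ^ (-β) * ρ ^ β := by
    rw [Real.div_rpow hr0.le hρ0.le, Real.rpow_neg hρ0.le, div_inv_eq_mul]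
  have hinv : ρ ^ (-β) * ρ ^ β = 1 := by rw [← Real.rpow_add hρ0]; simp
  rw [foldedIncrement, cappedPower_of_one_le hρ, cappedPower_of_one_le (hρ.trans hr.le), e1]
  split_ifs with h
  · have h1 : cappedPower β M (ρ ^ 2 / r) = M := if_pos ((div_lt_one hr0).2 h)
    rw [h1]
    linear_combination (-r ^ (-β)) * hinv
  · have h1 : 1 ≤ ρ ^ 2 / r := (one_le_div hr0).2 (not_lt.1 h)
    have e2 : (ρ ^ 2 / r) ^ (-β) = ρ ^ (-β) * ρ ^ (-β) * r ^ β := by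
      rw [Real.div_rpow (by positivity) hr0.le, Real.rpow_neg hr0.le, div_inv_eq_mul, sq,
        Real.mul_rpow hρ0.le hρ0.le]
    have hinv2 : r ^ (-β) * r ^ β = 1 := by rw [← Real.rpow_add hr0]; simp
    rw [cappedPower_of_one_le h1, e2]
    linear_combination (ρ ^ (-β) * (ρ ^ (-β) * ρ ^ β) ) * hinv2
      + (ρ ^ (-β) - r ^ (-β)) * hinv

lemma powKernel_sub_bounds {a : ℝ} (ha : 0 ≤ a) {y : EuclideanSpace ℝ (Fin k)}
    (hy : y ≠ 0) (h : 2 * ‖e‖ ≤ ‖y‖) :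
    (2 ^ ((k : ℝ) + a))⁻¹ * powKernel a y ≤ powKernel a (y - e) ∧
      powKernel a (y - e) ≤ 2 ^ ((k : ℝ) + a) * powKernel a y := by
  have hy0 : 0 < ‖y‖ := norm_pos_iff.2 hy
  have h1 : ‖y - e‖ ≤ 2 * ‖y‖ := (norm_sub_le y e).trans (by linarith [norm_nonneg e])
  have h2 : 2⁻¹ * ‖y‖ ≤ ‖y - e‖ := by linarith [norm_sub_norm_le y e]
  have hd : -((k : ℝ) + a) ≤ 0 := by linarith [Nat.cast_nonneg (α := ℝ) k]
  have h3 : 0 < ‖y - e‖ := lt_of_lt_of_le (by positivity) h2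
  unfold powKernel
  constructor
  · rw [← Real.rpow_neg (by norm_num), ← Real.mul_rpow (by norm_num) hy0.le]
    exact Real.rpow_le_rpow_of_nonpos h3 h1 hd
  · have h4 : (2 : ℝ) ^ ((k : ℝ) + a) = 2⁻¹ ^ (-((k : ℝ) + a)) := by
      rw [Real.inv_rpow (by norm_num), Real.rpow_neg (by norm_num), inv_inv]
    rw [h4, ← Real.mul_rpow (by norm_num) hy0.le]
    exact Real.rpow_le_rpow_of_nonpos (by positivity) h2 hd

/-- The capped fundamental solution is `s`-subharmonic away from the core, once the mass in the core
is large enough. -/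
lemma exists_cappedPower_subharmonic (hk : 1 ≤ k) (hs : 1 / 2 < s) (hs1 : s < 1)
    (hks : 2 * s ≤ k) :
    ∃ M : ℝ, 1 ≤ M ∧ ∀ e : EuclideanSpace ℝ (Fin k), 2 ≤ ‖e‖ →
      0 ≤ symIntegral s (fun y => cappedPower ((k : ℝ) - 2 * s) M ‖y‖) e := by
  set β : ℝ := (k : ℝ) - 2 * s with hβ
  set d : ℝ := (k : ℝ) + 2 * s with hd
  set I₁ := ∫ τ in {τ : EuclideanSpace ℝ (Fin k) | 1 < ‖τ‖}, powKernel (k : ℝ) τ with hI₁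
  set I₂ := ∫ τ in {τ : EuclideanSpace ℝ (Fin k) | 1 < ‖τ‖}, powKernel (2 * s) τ with hI₂
  have hk0 : (0 : ℝ) < k := by exact_mod_cast hk
  have hI₁p : 0 < I₁ := setIntegral_powKernel_pos hk hk0
  have h2d : (0 : ℝ) < 2 ^ d := Real.rpow_pos_of_pos two_pos _
  set M := max 1 (2 ^ d * 2 ^ d * I₂ / I₁) with hM
  have hM1 : 1 ≤ M := le_max_left _ _
  have hMI : 2 ^ d * 2 ^ d * I₂ ≤ M * I₁ := by
    rw [← div_le_iff₀ hI₁p]; exact le_max_right _ _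
  refine ⟨M, hM1, fun e he2 => ?_⟩
  have hρ : 0 < ‖e‖ := by linarith
  have he : e ≠ 0 := norm_pos_iff.1 hρ
  have hβ0 : 0 ≤ β := by linarith
  have hcd := contDiffAt_cappedPower (β := β) (M := M) (by linarith : 1 < ‖e‖)
  rw [symIntegral_radial hk hs hs1 hks (measurable_cappedPower β M) (abs_cappedPower_le hβ0 hM1) he
    hcd]
  have hGi := integrableOn_foldedIncrement hk hs hs1 hβ0 (measurable_cappedPower β M)
    (abs_cappedPower_le hβ0 hM1) he hcd
  set T : Set (EuclideanSpace ℝ (Fin k)) := {y | ‖e‖ ^ 2 < ‖y‖} with hT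
  have hTA : T ⊆ {y | ‖e‖ < ‖y‖} := fun y (hy : ‖e‖ ^ 2 < ‖y‖) => by
    rw [mem_ofPred_eq]; nlinarith
  have hTm : MeasurableSet T := measurableSet_norm_gt _
  rw [setIntegral_eq_of_subset_of_forall_sdiff_eq_zero (measurableSet_norm_gt _) hTA fun y hy => by
    rw [foldedIncrement_cappedPower (by linarith) hy.1,
      if_neg (show ¬‖e‖ ^ 2 < ‖y‖ from hy.2), zero_mul]]
  have hρ2 : 0 < ‖e‖ ^ 2 := by positivity
  have hlow : IntegrableOn (fun y : EuclideanSpace ℝ (Fin k) =>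
      M * ‖e‖ ^ β * (2 ^ d)⁻¹ * powKernel (k : ℝ) y
        - ‖e‖ ^ (-β) * 2 ^ d * powKernel (2 * s) y) T :=
    ((integrableOn_powKernel hk hk0 hρ2).const_mul _).sub
      ((integrableOn_powKernel hk (by linarith) hρ2).const_mul _)
  refine le_trans ?_ (setIntegral_mono_on hlow (hGi.mono_set hTA) hTm fun y hy => ?_)
  · rw [integral_sub ((integrableOn_powKernel hk hk0 hρ2).const_mul _)
      ((integrableOn_powKernel hk (by linarith) hρ2).const_mul _), integral_const_mul,
      integral_const_mul, setIntegral_powKernel k _ hρ2, setIntegral_powKernel k _ hρ2,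
      ← hI₁, ← hI₂, ← Real.rpow_natCast ‖e‖ 2, ← Real.rpow_mul hρ.le, ← Real.rpow_mul hρ.le]
    have e1 : ‖e‖ ^ β * ‖e‖ ^ (((2 : ℕ) : ℝ) * -(k : ℝ)) = ‖e‖ ^ (-d) := by
      rw [← Real.rpow_add hρ, hβ, hd]; push_cast; ring_nf
    have e2 : ‖e‖ ^ (-β) * ‖e‖ ^ (((2 : ℕ) : ℝ) * -(2 * s)) = ‖e‖ ^ (-d) := by
      rw [← Real.rpow_add hρ, hβ, hd]; push_cast; ring_nf
    have e3 : M * ‖e‖ ^ β * (2 ^ d)⁻¹ * (‖e‖ ^ (((2 : ℕ) : ℝ) * -(k : ℝ)) * I₁)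
        - ‖e‖ ^ (-β) * 2 ^ d * (‖e‖ ^ (((2 : ℕ) : ℝ) * -(2 * s)) * I₂)
        = ‖e‖ ^ (-d) * (2 ^ d)⁻¹ * (M * I₁ - 2 ^ d * 2 ^ d * I₂) := by
      have h4 : (2 ^ d : ℝ)⁻¹ * 2 ^ d = 1 := inv_mul_cancel₀ h2d.ne'
      linear_combination (M * (2 ^ d)⁻¹ * I₁) * e1 - 2 ^ d * I₂ * e2
        + ‖e‖ ^ (-d) * 2 ^ d * I₂ * h4
    rw [e3]
    have : 0 < ‖e‖ ^ (-d) := Real.rpow_pos_of_pos hρ _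
    exact mul_nonneg (by positivity) (by linarith)
  · have hy2 : ‖e‖ ^ 2 < ‖y‖ := hy
    have hy0 : 0 < ‖y‖ := hρ2.trans hy2
    obtain ⟨b1, b2⟩ := powKernel_sub_bounds (e := e) (a := 2 * s) (by linarith)
      (norm_pos_iff.1 hy0) (by nlinarith)
    rw [foldedIncrement_cappedPower (by linarith) (hTA hy), if_pos hy2, sub_mul]
    have h1 : ‖y‖ ^ (-β) * powKernel (2 * s) y = powKernel (k : ℝ) y := by
      unfold powKernel
      rw [← Real.rpow_add hy0, hβ]; ring_nf
    have hp1 : 0 ≤ M * ‖e‖ ^ β * ‖y‖ ^ (-β) := by positivity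
    have hp2 : 0 ≤ ‖e‖ ^ (-β) := by positivity
    have m1 := mul_le_mul_of_nonneg_left b1 hp1
    have m2 := mul_le_mul_of_nonneg_left b2 hp2
    have e1 : M * ‖e‖ ^ β * (2 ^ d)⁻¹ * powKernel (k : ℝ) y
        = M * ‖e‖ ^ β * ‖y‖ ^ (-β) * ((2 ^ d)⁻¹ * powKernel (2 * s) y) := by
      rw [← h1]; ring
    rw [e1, mul_assoc (‖e‖ ^ (-β))]
    exact sub_le_sub m1 m2

/-- The function `r^{-β} log r` outside the unit ball, extended by zero. -/
def logPower (β r : ℝ) : ℝ := if r < 1 then 0 else r ^ (-β) * Real.log r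

lemma logPower_of_one_le {β r : ℝ} (hr : 1 ≤ r) : logPower β r = r ^ (-β) * Real.log r :=
  if_neg (not_lt.2 hr)

lemma logPower_nonneg (β r : ℝ) : 0 ≤ logPower β r := by
  unfold logPower
  split_ifs with h
  · exact le_rfl
  · have h1 : 1 ≤ r := not_lt.1 h
    exact mul_nonneg (Real.rpow_nonneg (by linarith) _) (Real.log_nonneg h1)

lemma le_logPower {β r : ℝ} (hr : 0 < r) : r ^ (-β) * Real.log r ≤ logPower β r := by
  unfold logPower
  split_ifs with h
  · exact mul_nonpos_of_nonneg_of_nonpos (Real.rpow_nonneg hr.le _) (Real.log_nonpos hr.le h.le)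
  · exact le_rfl

lemma logPower_le {β : ℝ} (hβ : 0 < β) (r : ℝ) : logPower β r ≤ 1 / β := by
  unfold logPower
  split_ifs with h
  · positivity
  · have h1 : 0 < r := by linarith
    have h2 := Real.log_le_rpow_div h1.le hβ
    calc r ^ (-β) * Real.log r ≤ r ^ (-β) * (r ^ β / β) :=
          mul_le_mul_of_nonneg_left h2 (Real.rpow_nonneg h1.le _)
      _ = 1 / β := by rw [← mul_div_assoc, ← Real.rpow_add h1]; simp

lemma abs_logPower_le {β : ℝ} (hβ : 0 < β) (r : ℝ) : |logPower β r| ≤ 1 / β := by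
  rw [abs_of_nonneg (logPower_nonneg β r)]; exact logPower_le hβ r

lemma measurable_logPower (β : ℝ) : Measurable (logPower β) :=
  Measurable.ite measurableSet_Iio measurable_const (by fun_prop)

lemma contDiffAt_logPower {β r : ℝ} (hr : 1 < r) : ContDiffAt ℝ 2 (logPower β) r := by
  have h0 : r ≠ 0 := by linarith
  have h1 : ContDiffAt ℝ 2 (fun r : ℝ => r ^ (-β) * Real.log r) r :=
    (contDiffAt_id.rpow_const_of_ne h0).mul (contDiffAt_id.log h0)
  refine h1.congr_of_eventuallyEq ?_
  filter_upwards [lt_mem_nhds hr] with t ht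
  exact logPower_of_one_le (le_of_lt ht)

lemma continuousOn_logPower (β : ℝ) : ContinuousOn (logPower β) (Ici 1) := by
  have h1 : ContinuousOn (fun r : ℝ => r ^ (-β) * Real.log r) (Ici 1) := fun r hr => by
    have h0 : r ≠ 0 := by have : (1 : ℝ) ≤ r := hr; linarith
    exact ((Real.continuousAt_rpow_const r _ (Or.inl h0)).mul
      (Real.continuousAt_log h0)).continuousWithinAt
  exact h1.congr fun r hr => logPower_of_one_le hr

lemma tendsto_logPower {β : ℝ} (hβ : 0 < β) : Tendsto (logPower β) atTop (𝓝 0) := by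
  have h := (isLittleO_log_rpow_atTop hβ).tendsto_div_nhds_zero
  refine h.congr' ?_
  filter_upwards [eventually_ge_atTop 1] with r hr
  rw [logPower_of_one_le hr, Real.rpow_neg (by linarith), div_eq_inv_mul]

lemma one_sub_rpow_mul_log_le {β t σ : ℝ} (hs : 0 < s) (hs1 : s < 1) (hβ : 0 ≤ β) (ht : 1 ≤ t)
    (hσ : t - 1 ≤ σ) : (1 - t ^ (-β)) * Real.log t ≤ (β + 2 / s + 1) * cutWeight s σ := by
  have ht0 : 0 < t := by linarith
  have hσ0 : 0 ≤ σ := by linarith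
  have hl0 : 0 ≤ Real.log t := Real.log_nonneg ht
  have hlσ : Real.log t ≤ σ := (Real.log_le_sub_one_of_pos ht0).trans hσ
  have hp0 : 0 < t ^ (-β) := Real.rpow_pos_of_pos ht0 _
  have h1 : 1 - t ^ (-β) ≤ β * Real.log t := by
    rw [Real.rpow_def_of_pos ht0]
    linarith [Real.add_one_le_exp (Real.log t * -β)]
  have h2s : 0 < 2 / s := by positivity
  have hσs : 0 ≤ σ ^ s := Real.rpow_nonneg hσ0 _
  have hsq : (1 - t ^ (-β)) * Real.log t ≤ (β + 2 / s + 1) * σ ^ 2 := by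
    have a1 : (1 - t ^ (-β)) * Real.log t ≤ β * Real.log t * Real.log t :=
      mul_le_mul_of_nonneg_right h1 hl0
    have a2 : Real.log t * Real.log t ≤ σ ^ 2 := by
      rw [sq]; exact mul_le_mul hlσ hlσ hl0 hσ0
    have a3 := mul_le_mul_of_nonneg_left a2 hβ
    have a4 : 0 ≤ (2 / s + 1) * σ ^ 2 := by positivity
    linarith
  have hrp : (1 - t ^ (-β)) * Real.log t ≤ (β + 2 / s + 1) * σ ^ s := by
    have a1 : (1 - t ^ (-β)) * Real.log t ≤ Real.log t :=
      mul_le_of_le_one_left hl0 (by linarith)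
    rcases le_or_gt σ 1 with h | h
    · have a2 : σ ≤ σ ^ s := by
        rcases hσ0.eq_or_lt with h0 | h0
        · rw [← h0, Real.zero_rpow hs.ne']
        · simpa using Real.rpow_le_rpow_of_exponent_ge h0 h hs1.le
      have a3 : 0 ≤ (β + 2 / s) * σ ^ s := by positivity
      linarith
    · have a2 : t ^ s ≤ 2 * σ ^ s := by
        calc t ^ s ≤ (2 * σ) ^ s := Real.rpow_le_rpow ht0.le (by linarith) hs.le
          _ = 2 ^ s * σ ^ s := Real.mul_rpow (by norm_num) hσ0
          _ ≤ 2 ^ (1 : ℝ) * σ ^ s := mul_le_mul_of_nonneg_right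
              (Real.rpow_le_rpow_of_exponent_le (by norm_num) hs1.le) hσs
          _ = 2 * σ ^ s := by rw [Real.rpow_one]
      have a3 : Real.log t ≤ 2 / s * σ ^ s := by
        refine (Real.log_le_rpow_div ht0.le hs).trans ?_
        rw [div_mul_eq_mul_div]
        exact div_le_div_of_nonneg_right a2 hs.le
      have a4 : 0 ≤ (β + 1) * σ ^ s := by positivity
      linarith
  unfold cutWeight
  rcases min_choice (σ ^ 2) (σ ^ s) with h | h <;> rw [h]
  · exact hsq
  · exact hrp

lemma neg_le_foldedIncrement_logPower {β ρ r : ℝ} (hρ : 1 ≤ ρ) (hr : ρ < r) :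
    -(ρ ^ (-β) * ((1 - (r / ρ) ^ (-β)) * Real.log (r / ρ)))
      ≤ foldedIncrement β (logPower β) ρ r := by
  have hρ0 : 0 < ρ := by linarith
  have hr0 : 0 < r := hρ0.trans hr
  set t := r / ρ with ht
  have ht0 : 0 < t := by positivity
  have hrt : r = ρ * t := by rw [ht]; field_simp
  have hqt : ρ ^ 2 / r = ρ / t := by rw [hrt]; field_simp
  have htp : 0 < t ^ (-β) := Real.rpow_pos_of_pos ht0 _
  have h1 := le_logPower (β := β) (r := ρ / t) (by positivity)
  rw [foldedIncrement, logPower_of_one_le hρ, logPower_of_one_le (hρ.trans hr.le), ← ht, hqt]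
  have h2 := mul_le_mul_of_nonneg_right h1 htp.le
  have e1 : (ρ / t) ^ (-β) * Real.log (ρ / t) * t ^ (-β)
      = ρ ^ (-β) * (Real.log ρ - Real.log t) := by
    rw [Real.div_rpow hρ0.le ht0.le, Real.log_div hρ0.ne' ht0.ne']
    field_simp
  rw [e1] at h2
  have e2 : r ^ (-β) * Real.log r = ρ ^ (-β) * t ^ (-β) * (Real.log ρ + Real.log t) := by
    rw [hrt, Real.mul_rpow hρ0.le ht0.le, Real.log_mul hρ0.ne' ht0.ne']
  rw [e2]
  linarith

/-- The fundamental solution times the logarithm fails to be `s`-subharmonic by at most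
`C |e|^{-k}`: in the folded increment all terms cancel except `-ρ^{-β} (1 - (r/ρ)^{-β}) log (r/ρ)`. -/
lemma exists_neg_le_symIntegral_logPower (hk : 1 ≤ k) (hs : 1 / 2 < s) (hs1 : s < 1)
    (hks : 2 * s < k) :
    ∃ C : ℝ, 0 ≤ C ∧ ∀ e : EuclideanSpace ℝ (Fin k), 1 < ‖e‖ →
      -(C * ‖e‖ ^ (-(k : ℝ))) ≤ symIntegral s (fun y => logPower ((k : ℝ) - 2 * s) ‖y‖) e := by
  set β : ℝ := (k : ℝ) - 2 * s with hβ
  have hβ0 : 0 < β := by linarith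
  have hs0 : 0 < s := by linarith
  set c := ∫ τ : EuclideanSpace ℝ (Fin k), cutWeight s ‖τ‖ * powKernel (2 * s) τ with hc
  have hc0 : 0 ≤ c := integral_cutWeight_nonneg k s
  set D := β + 2 / s + 1 with hD
  have hD0 : 0 ≤ D := by positivity
  refine ⟨D * c, by positivity, fun e he1 => ?_⟩
  have hρ : 0 < ‖e‖ := by linarith
  have he : e ≠ 0 := norm_pos_iff.1 hρ
  have hcd := contDiffAt_logPower (β := β) he1
  rw [symIntegral_radial hk hs hs1 hks.le (measurable_logPower β) (abs_logPower_le hβ0) he hcd]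
  have hGi := integrableOn_foldedIncrement hk hs hs1 hβ0.le (measurable_logPower β)
    (abs_logPower_le hβ0) he hcd
  have hWi := (integrable_cutWeight hk hs hs1 hρ).comp_sub_right e
  have hWc : ∫ y : EuclideanSpace ℝ (Fin k),
      cutWeight s (‖y - e‖ / ‖e‖) * powKernel (2 * s) (y - e) = ‖e‖ ^ (-(2 * s)) * c := by
    rw [integral_sub_right_eq_self (fun τ : EuclideanSpace ℝ (Fin k) =>
      cutWeight s (‖τ‖ / ‖e‖) * powKernel (2 * s) τ), integral_cutWeight k s hρ]
  have hW0 : ∀ y : EuclideanSpace ℝ (Fin k),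
      0 ≤ cutWeight s (‖y - e‖ / ‖e‖) * powKernel (2 * s) (y - e) := fun y =>
    mul_nonneg (cutWeight_nonneg (by positivity)) (powKernel_nonneg _ _)
  have h1 : ∫ y in {y : EuclideanSpace ℝ (Fin k) | ‖e‖ < ‖y‖},
      -(‖e‖ ^ (-β) * D) * (cutWeight s (‖y - e‖ / ‖e‖) * powKernel (2 * s) (y - e))
      ≤ ∫ y in {y : EuclideanSpace ℝ (Fin k) | ‖e‖ < ‖y‖},
        foldedIncrement β (logPower β) ‖e‖ ‖y‖ * powKernel (2 * s) (y - e) := by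
    refine setIntegral_mono_on (hWi.const_mul _).integrableOn hGi (measurableSet_norm_gt _)
      fun y hy => ?_
    have hy' : ‖e‖ < ‖y‖ := hy
    rw [← mul_assoc]
    refine mul_le_mul_of_nonneg_right ?_ (powKernel_nonneg _ _)
    refine le_trans ?_ (neg_le_foldedIncrement_logPower he1.le hy')
    have h2 := one_sub_rpow_mul_log_le (β := β) (t := ‖y‖ / ‖e‖) (σ := ‖y - e‖ / ‖e‖) hs0 hs1
      hβ0.le ((one_le_div hρ).2 hy'.le) (by
        rw [div_sub_one hρ.ne']
        exact div_le_div_of_nonneg_right (norm_sub_norm_le y e) hρ.le)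
    have h3 := mul_le_mul_of_nonneg_left h2 (Real.rpow_nonneg hρ.le (-β))
    rw [neg_mul]
    refine neg_le_neg (h3.trans (le_of_eq ?_))
    ring
  have h2 : ∫ y in {y : EuclideanSpace ℝ (Fin k) | ‖e‖ < ‖y‖},
      cutWeight s (‖y - e‖ / ‖e‖) * powKernel (2 * s) (y - e) ≤ ‖e‖ ^ (-(2 * s)) * c := by
    rw [← hWc]
    exact setIntegral_le_integral hWi (Eventually.of_forall hW0)
  rw [integral_const_mul] at h1
  refine le_trans ?_ h1
  have h3 := mul_le_mul_of_nonneg_left h2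
    (mul_nonneg (Real.rpow_nonneg hρ.le (-β)) hD0)
  have e1 : ‖e‖ ^ (-β) * ‖e‖ ^ (-(2 * s)) = ‖e‖ ^ (-(k : ℝ)) := by
    rw [← Real.rpow_add hρ, hβ]; ring_nf
  have e2 : ‖e‖ ^ (-β) * D * (‖e‖ ^ (-(2 * s)) * c) = D * c * ‖e‖ ^ (-(k : ℝ)) := by
    rw [← e1]; ring
  linarith

end Barrier

/-! ### Nonexistence up to the critical exponent -/

section Nonexistence

variable {N k : ℕ} {s p : ℝ} {u : EuclideanSpace ℝ (Fin N) → ℝ}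

lemma contDiffOn_radial {f : ℝ → ℝ} (hf : ∀ r, 1 < r → ContDiffAt ℝ 2 f r)
    (x : EuclideanSpace ℝ (Fin N)) :
    ContDiffOn ℝ 2 (fun y : EuclideanSpace ℝ (Fin N) => f ‖y‖) (Metric.ball x (‖x‖ - 1)) := by
  intro y hy
  have h1 : ‖y - x‖ < ‖x‖ - 1 := by simpa [dist_eq_norm] using hy
  have h2 : 1 < ‖y‖ := by
    have := norm_sub_norm_le x y
    rw [norm_sub_rev] at this
    linarith
  have h3 : y ≠ 0 := norm_pos_iff.1 (by linarith)
  exact (ContDiffAt.comp y (hf _ h2) (contDiffAt_norm ℝ h3)).contDiffWithinAt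

lemma exists_forall_le_of_norm_le (hu : LowerSemicontinuous u) {R : ℝ} (hR : 0 ≤ R) :
    ∃ z, ‖z‖ ≤ R ∧ ∀ y, ‖y‖ ≤ R → u z ≤ u y := by
  obtain ⟨z, hz, h⟩ := (hu.lowerSemicontinuousOn _).exists_isMinOn
    ⟨0, Metric.mem_closedBall_self hR⟩ (isCompact_closedBall (0 : EuclideanSpace ℝ (Fin N)) R)
  exact ⟨z, by simpa using hz, fun y hy => h (by simpa using hy)⟩

/-- Positive supersolutions decay at most like the fundamental solution. -/
lemma IsViscositySupersolution.exists_power_le (hk : 1 ≤ k) (hkN : k ≤ N) (hs : 1 / 2 < s)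
    (hs1 : s < 1) (hks : 2 * s < k) (hpos : ∀ x, 0 < u x)
    (hu : IsViscositySupersolution k s p u) :
    ∃ c, 0 < c ∧ ∀ x, 1 ≤ ‖x‖ → c * ‖x‖ ^ (-((k : ℝ) - 2 * s)) ≤ u x := by
  set β : ℝ := (k : ℝ) - 2 * s with hβ
  have hβ0 : 0 < β := by linarith
  obtain ⟨M, hM1, hM⟩ := exists_cappedPower_subharmonic hk hs hs1 hks.le
  have hM0 : 0 < M := by linarith
  obtain ⟨x₀, -, hx₀⟩ := exists_forall_le_of_norm_le hu.1 (zero_le_two (α := ℝ))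
  set c := u x₀ / M with hc
  have hc0 : 0 < c := div_pos (hpos x₀) hM0
  set f : ℝ → ℝ := fun r => c * cappedPower β M r with hf
  refine ⟨c, hc0, fun z hz1 => ?_⟩
  by_contra! hlt
  have hfc : ∀ r, 1 < r → ContDiffAt ℝ 2 f r := fun r hr =>
    contDiffAt_const.mul (contDiffAt_cappedPower hr)
  have hlim : Tendsto f atTop (𝓝 0) := by
    have h := (tendsto_rpow_neg_atTop hβ0).const_mul c
    rw [mul_zero] at h
    refine h.congr' ?_
    filter_upwards [eventually_ge_atTop 1] with r hr
    simp only [hf]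
    rw [cappedPower_of_one_le hr]
  obtain ⟨x, hx2, hxu, hmin⟩ := exists_contact_radial (f := f) (r₀ := 2) hu.1
    (fun y => (hpos y).le)
    (fun r (hr : 2 ≤ r) => (hfc r (by linarith)).continuousAt.continuousWithinAt) hlim
    (fun y hy => by
      refine le_trans ?_ (hx₀ y hy.le)
      calc c * cappedPower β M ‖y‖ ≤ c * M :=
            mul_le_mul_of_nonneg_left ((le_abs_self _).trans (abs_cappedPower_le hβ0.le hM1 _))
              hc0.le
        _ = u x₀ := div_mul_cancel₀ _ hM0.ne')
    (z := z) (by simp only [hf]; rwa [cappedPower_of_one_le hz1])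
  obtain ⟨e, he, key⟩ := hu.contact_radial hk hkN hs hs1 (by linarith : 0 < ‖x‖ - 1)
    ((measurable_cappedPower β M).const_mul c) (B := c * M)
    (fun r => by
      rw [abs_mul, abs_of_pos hc0]
      exact mul_le_mul_of_nonneg_left (abs_cappedPower_le hβ0.le hM1 _) hc0.le)
    (contDiffOn_radial hfc x) hmin
  rw [symIntegral_const_mul s c fun τ => cappedPower β M ‖τ‖] at key
  have h1 := hM e (by rw [he]; exact hx2)
  have h2 := normConst_pos k (by linarith : 0 < s) hs1
  have h3 := Real.rpow_pos_of_pos (hpos x) p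
  have h4 := mul_nonneg h2.le (mul_nonneg hc0.le h1)
  linarith

/-- On bounded sets of values, a power dominates any larger power up to a constant. -/
lemma rpow_sub_mul_le_rpow {p q D t : ℝ} (hpq : p ≤ q) (ht : 0 < t) (htD : t ≤ D) :
    D ^ (p - q) * t ^ q ≤ t ^ p := by
  have h1 : D ^ (p - q) ≤ t ^ (p - q) :=
    Real.rpow_le_rpow_of_nonpos ht htD (by linarith)
  calc D ^ (p - q) * t ^ q ≤ t ^ (p - q) * t ^ q :=
        mul_le_mul_of_nonneg_right h1 (Real.rpow_nonneg ht.le _)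
    _ = t ^ p := by rw [← Real.rpow_add ht]; ring_nf

/-- Up to the critical exponent the zero order term forces a logarithmic gain over the fundamental
solution. -/
lemma IsViscositySupersolution.exists_logPower_le (hk : 1 ≤ k) (hkN : k ≤ N) (hs : 1 / 2 < s)
    (hs1 : s < 1) (hks : 2 * s < k) (hpos : ∀ x, 0 < u x)
    (hu : IsViscositySupersolution k s p u) (hp : p ≤ (k : ℝ) / ((k : ℝ) - 2 * s)) :
    ∃ c, 0 < c ∧ ∀ x, c * logPower ((k : ℝ) - 2 * s) ‖x‖ ≤ u x := by
  obtain ⟨c₁, hc₁, hlow⟩ := hu.exists_power_le hk hkN hs hs1 hks hpos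
  obtain ⟨C, hC, hlog⟩ := exists_neg_le_symIntegral_logPower hk hs hs1 hks
  set β : ℝ := (k : ℝ) - 2 * s with hβ
  have hβ0 : 0 < β := by linarith
  set q : ℝ := (k : ℝ) / β with hq
  have hβq : β * q = k := by rw [hq]; field_simp
  have hk0 : (0 : ℝ) < k := by exact_mod_cast hk
  have hq0 : 0 < q := div_pos hk0 hβ0
  have hn := normConst_pos k (by linarith : 0 < s) hs1
  set D : ℝ := 1 / β with hD
  have hD0 : 0 < D := by positivity
  set A : ℝ := D ^ (p - q) * c₁ ^ q with hA
  have hA0 : 0 < A := by positivity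
  -- the constant is so small that the zero order term dominates the defect of the barrier
  set c : ℝ := min 1 (A / (normConst k s * (C + 1))) with hc
  have hc0 : 0 < c := lt_min one_pos (by positivity)
  have hcA : c * (normConst k s * (C + 1)) ≤ A := by
    rw [← le_div_iff₀ (by positivity)]; exact min_le_right _ _
  refine ⟨c, hc0, fun z => ?_⟩
  by_contra! hlt
  set f : ℝ → ℝ := fun r => c * logPower β r with hf
  have hfc : ∀ r, 1 < r → ContDiffAt ℝ 2 f r := fun r hr =>
    contDiffAt_const.mul (contDiffAt_logPower hr)
  obtain ⟨x, hx1, hxu, hmin⟩ := exists_contact_radial (f := f) (r₀ := 1) hu.1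
    (fun y => (hpos y).le) (continuousOn_const.mul (continuousOn_logPower β))
    (by simpa using (tendsto_logPower hβ0).const_mul c)
    (fun y hy => by
      have : logPower β ‖y‖ = 0 := if_pos hy
      simp only [hf]
      rw [this, mul_zero]
      exact (hpos y).le) (z := z) hlt
  have hx1' : 1 < ‖x‖ := by
    refine lt_of_le_of_ne hx1 fun h => ?_
    have h1 : f ‖x‖ = 0 := by simp only [hf]; rw [← h, logPower_of_one_le le_rfl]; simp
    linarith [hpos x]
  have hx0 : 0 < ‖x‖ := by linarith
  obtain ⟨e, he, key⟩ := hu.contact_radial hk hkN hs hs1 (by linarith : 0 < ‖x‖ - 1)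
    ((measurable_logPower β).const_mul c) (B := c * D)
    (fun r => by
      rw [abs_mul, abs_of_pos hc0]
      exact mul_le_mul_of_nonneg_left (abs_logPower_le hβ0 _) hc0.le)
    (contDiffOn_radial hfc x) hmin
  rw [symIntegral_const_mul s c fun τ => logPower β ‖τ‖] at key
  have h1 := hlog e (by rw [he]; exact hx1')
  rw [he] at h1
  have hxD : u x ≤ D := by
    refine hxu.le.trans ?_
    calc c * logPower β ‖x‖ ≤ 1 * D :=
          mul_le_mul (min_le_left _ _) (logPower_le hβ0 _) (logPower_nonneg _ _) zero_le_one
      _ = D := one_mul D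
  have h2 := rpow_sub_mul_le_rpow hp (hpos x) hxD
  have hkx : 0 < ‖x‖ ^ (-(k : ℝ)) := Real.rpow_pos_of_pos hx0 _
  have h3 : A * ‖x‖ ^ (-(k : ℝ)) ≤ u x ^ p := by
    refine le_trans ?_ h2
    have h4 := Real.rpow_le_rpow (by positivity) (hlow x hx1) hq0.le
    rw [Real.mul_rpow hc₁.le (Real.rpow_nonneg hx0.le _), ← Real.rpow_mul hx0.le, neg_mul, hβq]
      at h4
    rw [hA, mul_assoc]
    exact mul_le_mul_of_nonneg_left h4 (by positivity)
  have h5 := mul_le_mul_of_nonneg_left h1 (mul_nonneg hn.le hc0.le)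
  have h6 := mul_le_mul_of_nonneg_right hcA hkx.le
  have h7 : 0 < normConst k s * c * ‖x‖ ^ (-(k : ℝ)) := by positivity
  nlinarith

/-- The scale-invariant minima of a positive supersolution stay bounded along dyadic scales. -/
lemma IsViscositySupersolution.exists_rescaled_min_le (hk : 1 ≤ k) (hkN : k ≤ N) (hs : 1 / 2 < s)
    (hs1 : s < 1) (hks : 2 * s < k) (hpos : ∀ x, 0 < u x)
    (hu : IsViscositySupersolution k s p u) (hp : p ≤ (k : ℝ) / ((k : ℝ) - 2 * s)) :
    ∃ X : ℝ, ∀ j : ℕ, ∃ z, ‖z‖ ≤ 2 ^ j ∧ u z * (2 ^ j) ^ ((k : ℝ) - 2 * s) ≤ X := by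
  obtain ⟨C, hC, hstep⟩ := hu.exists_rpow_le hk hkN hs hs1 hpos
  set β : ℝ := (k : ℝ) - 2 * s with hβ
  have hβ0 : 0 < β := by linarith
  set q : ℝ := (k : ℝ) / β with hq
  have hβq : β * q = k := by rw [hq]; field_simp
  have hq1 : 1 < q := by rw [hq, one_lt_div hβ0]; linarith
  have hq0 : 0 < q := by linarith
  set D : ℝ := 2 * u 0 with hD
  have hD0 : 0 < D := mul_pos two_pos (hpos 0)
  have hDp : 0 < D ^ (p - q) := Real.rpow_pos_of_pos hD0 _
  set C' : ℝ := 2 ^ (k : ℝ) * C / D ^ (p - q) with hC'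
  have hC'0 : 0 ≤ C' := by positivity
  choose z hz hzmin using fun j : ℕ =>
    exists_forall_le_of_norm_le hu.1 (by positivity : (0 : ℝ) ≤ 2 ^ j)
  set m : ℕ → ℝ := fun j => u (z j) * (2 ^ j) ^ β with hm
  have hm0 : ∀ j, 0 < m j := fun j => mul_pos (hpos _) (by positivity)
  have hrec : ∀ j, m (j + 1) ^ q ≤ C' * m j := by
    intro j
    set R : ℝ := 2 ^ j with hR
    have hR0 : 0 < R := by positivity
    obtain ⟨x, hx, hx2, hxp⟩ := hstep R hR0 (z j) (hz j)
    have h1 : u (z (j + 1)) ≤ u x := hzmin (j + 1) x (by rw [pow_succ]; linarith)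
    have h2 : u x ≤ D := by
      have := hzmin j 0 (by simp)
      linarith
    have h3 := rpow_sub_mul_le_rpow hp (hpos x) h2
    have h4 : u (z (j + 1)) ^ q ≤ u x ^ q := Real.rpow_le_rpow (hpos _).le h1 hq0.le
    have h5 : D ^ (p - q) * u (z (j + 1)) ^ q ≤ C * u (z j) * R ^ (-(2 * s)) :=
      (mul_le_mul_of_nonneg_left h4 hDp.le).trans (h3.trans hxp)
    have h6 : u (z (j + 1)) ^ q ≤ C * u (z j) * R ^ (-(2 * s)) / D ^ (p - q) := by
      rw [le_div_iff₀ hDp, mul_comm]; exact h5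
    have e1 : m (j + 1) ^ q = u (z (j + 1)) ^ q * (2 ^ (k : ℝ) * R ^ (k : ℝ)) := by
      simp only [hm]
      rw [Real.mul_rpow (hpos _).le (by positivity), ← Real.rpow_mul (by positivity), hβq, pow_succ,
        mul_comm (2 ^ j : ℝ), Real.mul_rpow (by norm_num) (by positivity)]
    have e2 : R ^ (-(2 * s)) * R ^ (k : ℝ) = R ^ β := by
      rw [← Real.rpow_add hR0, hβ]; ring_nf
    calc m (j + 1) ^ q = u (z (j + 1)) ^ q * (2 ^ (k : ℝ) * R ^ (k : ℝ)) := e1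
      _ ≤ C * u (z j) * R ^ (-(2 * s)) / D ^ (p - q) * (2 ^ (k : ℝ) * R ^ (k : ℝ)) :=
        mul_le_mul_of_nonneg_right h6 (by positivity)
      _ = C' * (u (z j) * (R ^ (-(2 * s)) * R ^ (k : ℝ))) := by rw [hC']; ring
      _ = C' * m j := by rw [e2]
  set X : ℝ := max (m 0) (C' ^ (1 / (q - 1))) with hX
  have hX0 : 0 < X := lt_max_of_lt_left (hm0 0)
  have hCX : C' ≤ X ^ (q - 1) := by
    have h1 : C' = (C' ^ (1 / (q - 1))) ^ (q - 1) := by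
      rw [← Real.rpow_mul hC'0, one_div_mul_cancel (by linarith), Real.rpow_one]
    rw [h1]
    exact Real.rpow_le_rpow (Real.rpow_nonneg hC'0 _) (le_max_right _ _) (by linarith)
  have hbd : ∀ j, m j ≤ X := by
    intro j
    induction j with
    | zero => exact le_max_left _ _
    | succ j ih =>
      have h1 : m (j + 1) ^ q ≤ X ^ q := by
        calc m (j + 1) ^ q ≤ C' * m j := hrec j
          _ ≤ X ^ (q - 1) * X := mul_le_mul hCX ih (hm0 j).le (by positivity)
          _ = X ^ q := by rw [← Real.rpow_add_one hX0.ne', sub_add_cancel]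
      exact (Real.rpow_le_rpow_iff (hm0 _).le hX0.le hq0).1 h1
  exact ⟨X, fun j => ⟨z j, hz j, hbd j⟩⟩

/-- No positive supersolution exists up to the critical exponent: the logarithmic gain contradicts
the boundedness of the rescaled minima. -/
theorem IsViscositySupersolution.critical_lt (hk : 1 ≤ k) (hkN : k ≤ N) (hs : 1 / 2 < s)
    (hs1 : s < 1) (hks : 2 * s < k) (hpos : ∀ x, 0 < u x)
    (hu : IsViscositySupersolution k s p u) : (k : ℝ) / ((k : ℝ) - 2 * s) < p := by
  by_contra! hp
  obtain ⟨c, hc, hlow⟩ := hu.exists_logPower_le hk hkN hs hs1 hks hpos hp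
  obtain ⟨X, hX⟩ := hu.exists_rescaled_min_le hk hkN hs hs1 hks hpos hp
  set β : ℝ := (k : ℝ) - 2 * s with hβ
  have hβ0 : 0 < β := by linarith
  -- outside the ball of radius `T` the logarithm beats the bound `X`
  set T : ℝ := Real.exp (max (X / c) 0 + 1) with hT
  have hT0 : 0 < T := Real.exp_pos _
  have hT1 : 1 ≤ T := Real.one_le_exp (by positivity)
  obtain ⟨y, -, hy⟩ := exists_forall_le_of_norm_le hu.1 hT0.le
  have hlim : Tendsto (fun j : ℕ => u y * ((2 : ℝ) ^ j) ^ β) atTop atTop :=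
    ((tendsto_rpow_atTop hβ0).comp (tendsto_pow_atTop_atTop_of_one_lt one_lt_two)).const_mul_atTop
      (hpos y)
  obtain ⟨j, hj⟩ := (hlim.eventually_gt_atTop X).exists
  obtain ⟨z, hz, hzX⟩ := hX j
  rcases le_or_gt ‖z‖ T with h | h
  · have h1 := mul_le_mul_of_nonneg_right (hy z h)
      (by positivity : (0 : ℝ) ≤ ((2 : ℝ) ^ j) ^ β)
    linarith
  · have hz0 : 0 < ‖z‖ := hT0.trans h
    have h1 := hlow z
    rw [logPower_of_one_le (hT1.trans h.le)] at h1
    have h2 : X < c * Real.log ‖z‖ := by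
      have h3 : max (X / c) 0 + 1 < Real.log ‖z‖ := (Real.lt_log_iff_exp_lt hz0).2 h
      have h4 : X / c < Real.log ‖z‖ := by linarith [le_max_left (X / c) 0]
      rw [div_lt_iff₀ hc] at h4
      linarith
    have hzb : 0 < ‖z‖ ^ β := Real.rpow_pos_of_pos hz0 _
    have h5 : ‖z‖ ^ β ≤ ((2 : ℝ) ^ j) ^ β := Real.rpow_le_rpow hz0.le hz hβ0.le
    have h6 : c * Real.log ‖z‖ ≤ u z * ‖z‖ ^ β := by
      have h7 := mul_le_mul_of_nonneg_right h1 hzb.le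
      have h8 : ‖z‖ ^ (-β) * ‖z‖ ^ β = 1 := by rw [← Real.rpow_add hz0]; simp
      have h9 : c * (‖z‖ ^ (-β) * Real.log ‖z‖) * ‖z‖ ^ β = c * Real.log ‖z‖ := by
        linear_combination (c * Real.log ‖z‖) * h8
      linarith
    have h10 := mul_le_mul_of_nonneg_left h5 (hpos z).le
    linarith

end Nonexistence

/-! ### Existence above the critical exponent -/

section Existence

variable {N k : ℕ} {s p : ℝ}

/-- Decrements of the convex function `x^{-σ}` over intervals of a fixed length decrease. -/
lemma rpow_neg_sub_le {σ c d h : ℝ} (hσ : 0 ≤ σ) (hc : 0 < c) (hcd : c ≤ d) (hh : 0 ≤ h) :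
    d ^ (-σ) - (d + h) ^ (-σ) ≤ c ^ (-σ) - (c + h) ^ (-σ) := by
  have hder : ∀ x : ℝ, 0 < x → HasDerivAt (fun x : ℝ => x ^ (-σ) - (x + h) ^ (-σ))
      (-σ * x ^ (-σ - 1) - -σ * (x + h) ^ (-σ - 1)) x := by
    intro x hx
    have h1 := Real.hasDerivAt_rpow_const (x := x) (p := -σ) (Or.inl hx.ne')
    have h2 := (Real.hasDerivAt_rpow_const (x := x + h) (p := -σ)
      (Or.inl (by linarith))).comp_add_const x h
    exact h1.sub h2
  have hanti : AntitoneOn (fun x : ℝ => x ^ (-σ) - (x + h) ^ (-σ)) (Ioi 0) := by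
    refine antitoneOn_of_deriv_nonpos (convex_Ioi 0)
      (fun x hx => (hder x hx).continuousAt.continuousWithinAt)
      (fun x hx => ?_) fun x hx => ?_
    · rw [interior_Ioi] at hx
      exact (hder x hx).differentiableAt.differentiableWithinAt
    · rw [interior_Ioi] at hx
      have hx0 : 0 < x := hx
      rw [(hder x hx).deriv]
      have h3 : (x + h) ^ (-σ - 1) ≤ x ^ (-σ - 1) :=
        Real.rpow_le_rpow_of_nonpos hx0 (by linarith) (by linarith)
      have := mul_le_mul_of_nonneg_left h3 hσ
      linarith
  exact hanti hc (hc.trans_le hcd) hcd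

/-- The profile `(b + r²)^{-γ/2}` of the supersolution on an affine plane. -/
def bubble (b γ r : ℝ) : ℝ := (b + r ^ 2) ^ (-(γ / 2))

section Bubble

variable {b γ β r ρ : ℝ}

lemma bubble_nonneg (hb : 0 < b) (r : ℝ) : 0 ≤ bubble b γ r :=
  Real.rpow_nonneg (by positivity) _

lemma abs_bubble_le (hb : 0 < b) (hγ : 0 ≤ γ) (r : ℝ) : |bubble b γ r| ≤ b ^ (-(γ / 2)) := by
  rw [abs_of_nonneg (bubble_nonneg hb r)]
  exact Real.rpow_le_rpow_of_nonpos hb (by nlinarith [sq_nonneg r]) (by linarith)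

lemma bubble_anti (hb : 0 < b) (hγ : 0 ≤ γ) (hρ : 0 ≤ ρ) (h : ρ ≤ r) :
    bubble b γ r ≤ bubble b γ ρ :=
  Real.rpow_le_rpow_of_nonpos (by positivity)
    (by linarith [pow_le_pow_left₀ hρ h 2]) (by linarith)

lemma contDiff_bubble (hb : 0 < b) : ContDiff ℝ 2 (bubble b γ) := by
  unfold bubble
  exact (contDiff_const.add (contDiff_id.pow 2)).rpow_const_of_ne fun r => by
    have := sq_nonneg r
    simp only [id]
    positivity

lemma contDiff_bubble_norm (hb : 0 < b) {n : ℕ} :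
    ContDiff ℝ 2 fun y : EuclideanSpace ℝ (Fin n) => bubble b γ ‖y‖ := by
  unfold bubble
  exact (contDiff_const.add (contDiff_norm_sq ℝ)).rpow_const_of_ne fun y => by positivity

lemma bubble_eq {A : ℝ} (hA : 0 < A) (h : A ^ 2 = b + ρ ^ 2) : bubble b γ ρ = A ^ (-γ) := by
  rw [bubble, ← h, ← Real.rpow_natCast, ← Real.rpow_mul hA.le]
  congr 1; push_cast; ring

/-- For `γ < β` the outward decrement of the profile dominates the inward increment. -/
lemma foldedIncrement_bubble_le (hb : 0 < b) (hγ : 0 ≤ γ) (hρ : 0 < ρ) (hr : ρ < r) :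
    foldedIncrement β (bubble b γ) ρ r
      ≤ -((bubble b γ ρ - bubble b γ r) * (1 - (r / ρ) ^ (γ - β))) := by
  set t := r / ρ with ht
  have hr0 : 0 < r := hρ.trans hr
  have ht1 : 1 < t := (one_lt_div hρ).2 hr
  have ht0 : 0 < t := by linarith
  have hrt : r = ρ * t := by rw [ht]; field_simp
  have hqt : ρ ^ 2 / r = ρ / t := by rw [hrt]; field_simp
  set T := t ^ 2 with hT
  have hT1 : 1 ≤ T := one_le_pow₀ ht1.le
  have hT0 : 0 < T := by linarith
  have hXT : ρ ^ 2 / T ≤ ρ ^ 2 := div_le_self (by positivity) hT1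
  have hbT : b / T ≤ b := div_le_self hb.le hT1
  have hconv := rpow_neg_sub_le (σ := γ / 2) (c := b / T + ρ ^ 2 / T) (d := b + ρ ^ 2 / T)
    (h := ρ ^ 2 - ρ ^ 2 / T) (by linarith) (by positivity) (by linarith) (by linarith)
  have hTσ : T ^ (γ / 2) = t ^ γ := by
    rw [hT, ← Real.rpow_natCast, ← Real.rpow_mul ht0.le]
    congr 1; push_cast; ring
  have scale : ∀ z, 0 ≤ z → (z / T) ^ (-(γ / 2)) = t ^ γ * z ^ (-(γ / 2)) := fun z hz => by
    rw [Real.div_rpow hz hT0.le, Real.rpow_neg hT0.le, div_inv_eq_mul, hTσ, mul_comm]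
  have e1 : (b / T + ρ ^ 2 / T) ^ (-(γ / 2)) = t ^ γ * bubble b γ ρ := by
    rw [← add_div, scale _ (by positivity)]; rfl
  have e2 : (b / T + ρ ^ 2 / T + (ρ ^ 2 - ρ ^ 2 / T)) ^ (-(γ / 2)) = t ^ γ * bubble b γ r := by
    have h1 : b / T + ρ ^ 2 / T + (ρ ^ 2 - ρ ^ 2 / T) = (b + r ^ 2) / T := by
      rw [hrt, mul_pow, ← hT]; field_simp; ring
    rw [h1, scale _ (by positivity)]; rfl
  have e3 : (b + ρ ^ 2 / T) ^ (-(γ / 2)) = bubble b γ (ρ / t) := by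
    rw [bubble, div_pow]
  have e4 : (b + ρ ^ 2 / T + (ρ ^ 2 - ρ ^ 2 / T)) ^ (-(γ / 2)) = bubble b γ ρ := by
    rw [bubble]; congr 1; ring
  rw [e1, e2, e3, e4] at hconv
  have htβ : 0 ≤ t ^ (-β) := Real.rpow_nonneg ht0.le _
  have e5 : t ^ γ * t ^ (-β) = t ^ (γ - β) := by rw [← Real.rpow_add ht0, sub_eq_add_neg]
  have h2 := mul_le_mul_of_nonneg_right hconv htβ
  rw [foldedIncrement, hqt, ← e5]
  linarith

end Bubble

/-- The bubble is a strict supersolution on `ℝ^k`, with a bound that is uniform in the distance of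
the affine plane from the origin. -/
lemma exists_symIntegral_bubble_le (hk : 1 ≤ k) (hs : 1 / 2 < s) (hs1 : s < 1) (hks : 2 * s ≤ k)
    {γ : ℝ} (hγ : 0 < γ) (hγβ : γ < (k : ℝ) - 2 * s) :
    ∃ c, 0 < c ∧ ∀ b, 0 < b → ∀ (e : EuclideanSpace ℝ (Fin k)) (A : ℝ), 0 < A →
      A ^ 2 = b + ‖e‖ ^ 2 →
      symIntegral s (fun y => bubble b γ ‖y‖) e ≤ -(c * A ^ (-(γ + 2 * s))) := by
  set β : ℝ := (k : ℝ) - 2 * s with hβ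
  set d : ℝ := (k : ℝ) + 2 * s with hd
  set I := ∫ τ in {τ : EuclideanSpace ℝ (Fin k) | 1 < ‖τ‖}, powKernel (2 * s) τ with hI
  have hI0 : 0 < I := setIntegral_powKernel_pos hk (by linarith)
  have h2γ : (2 : ℝ) ^ (-γ) < 1 := Real.rpow_lt_one_of_one_lt_of_neg one_lt_two (by linarith)
  have h2β : (2 : ℝ) ^ (γ - β) < 1 := Real.rpow_lt_one_of_one_lt_of_neg one_lt_two (by linarith)
  have h2d : (0 : ℝ) < (2 ^ d)⁻¹ := by positivity
  have h2d1 : ((2 : ℝ) ^ d)⁻¹ ≤ 1 := inv_le_one_of_one_le₀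
    (Real.one_le_rpow one_le_two (by have := Nat.cast_nonneg (α := ℝ) k; linarith))
  have h2βp : (0 : ℝ) < 2 ^ (γ - β) := Real.rpow_pos_of_pos two_pos _
  set c₁ : ℝ := (1 - 2 ^ (-γ)) * (1 - 2 ^ (γ - β)) * (2 ^ d)⁻¹ with hc₁
  have hc₁0 : 0 < c₁ := mul_pos (mul_pos (by linarith) (by linarith)) h2d
  refine ⟨c₁ * (2 ^ (-(2 * s)) * I), by positivity, fun b hb e A hA hAe => ?_⟩
  set T : Set (EuclideanSpace ℝ (Fin k)) := {y | 2 * A < ‖y‖} with hT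
  have hTm : MeasurableSet T := measurableSet_norm_gt _
  have h2A : 0 < 2 * A := by linarith
  have hKT := (integrableOn_powKernel (k := k) hk (by linarith : 0 < 2 * s) h2A)
  have heA : ‖e‖ ≤ A := by
    refine (pow_le_pow_iff_left₀ (norm_nonneg e) hA.le two_ne_zero).1 ?_
    linarith
  have hAγ : 0 < A ^ (-γ) := Real.rpow_pos_of_pos hA _
  have hρv : bubble b γ ‖e‖ = A ^ (-γ) := bubble_eq hA hAe
  -- far from the origin the profile has dropped by a fixed factor
  have hdrop : ∀ y ∈ T, (1 - 2 ^ (-γ)) * A ^ (-γ) ≤ bubble b γ ‖e‖ - bubble b γ ‖y‖ := by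
    intro y hy
    have hy' : 2 * A < ‖y‖ := hy
    have h1 : bubble b γ ‖y‖ ≤ 2 ^ (-γ) * A ^ (-γ) := by
      rw [← Real.mul_rpow zero_le_two hA.le]
      have h2 : (2 * A) ^ (-γ) = ((2 * A) ^ 2) ^ (-(γ / 2)) := by
        rw [← Real.rpow_natCast, ← Real.rpow_mul h2A.le]
        congr 1; push_cast; ring
      rw [h2]
      exact Real.rpow_le_rpow_of_nonpos (by positivity)
        (by linarith [pow_le_pow_left₀ h2A.le hy'.le 2]) (by linarith)
    rw [hρv]
    linarith
  have hval : ∫ y in T, -(c₁ * A ^ (-γ)) * powKernel (2 * s) y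
      = -(c₁ * (2 ^ (-(2 * s)) * I) * A ^ (-(γ + 2 * s))) := by
    rw [integral_const_mul, setIntegral_powKernel k _ h2A, ← hI,
      Real.mul_rpow zero_le_two hA.le, neg_add, Real.rpow_add hA]
    ring
  rw [← hval]
  rcases eq_or_ne e 0 with rfl | he
  · have hi := integrable_symDiff (F := fun y => bubble b γ ‖y‖) (e := 0) hk hs hs1
      (contDiff_bubble_norm hb).continuous.measurable (fun y => abs_bubble_le hb hγ.le _)
      (contDiff_bubble_norm hb).contDiffAt
    have hsd : ∀ τ : EuclideanSpace ℝ (Fin k), symDiff (fun y => bubble b γ ‖y‖) 0 τ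
        = -(bubble b γ ‖(0 : EuclideanSpace ℝ (Fin k))‖ - bubble b γ ‖τ‖) := fun τ => by
      simp only [symDiff, zero_add, zero_sub, norm_neg]; ring
    rw [symIntegral, ← integral_indicator hTm]
    refine integral_mono hi ((integrable_indicator_iff hTm).2 (hKT.const_mul _)) fun τ => ?_
    simp only [hsd]
    by_cases hτ : τ ∈ T
    · rw [indicator_of_mem hτ]
      refine mul_le_mul_of_nonneg_right (neg_le_neg ?_) (powKernel_nonneg _ _)
      refine le_trans (mul_le_mul_of_nonneg_right ?_ hAγ.le) (hdrop τ hτ)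
      rw [hc₁, mul_assoc]
      exact mul_le_of_le_one_right (by linarith)
        (mul_le_one₀ (by linarith) h2d.le h2d1)
    · rw [indicator_of_notMem hτ]
      refine mul_nonpos_of_nonpos_of_nonneg (neg_nonpos.2 (sub_nonneg.2 ?_)) (powKernel_nonneg _ _)
      exact bubble_anti hb hγ.le (norm_nonneg _) (by simp)
  · have hρ : 0 < ‖e‖ := norm_pos_iff.2 he
    have hcd : ContDiffAt ℝ 2 (bubble b γ) ‖e‖ := (contDiff_bubble hb).contDiffAt
    have hfm := (contDiff_bubble (γ := γ) hb).continuous.measurable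
    rw [symIntegral_radial hk hs hs1 hks hfm (abs_bubble_le hb hγ.le) he hcd]
    have hGi := integrableOn_foldedIncrement hk hs hs1 (β := β) (by linarith) hfm
      (abs_bubble_le hb hγ.le) he hcd
    have hTA : T ⊆ {y | ‖e‖ < ‖y‖} := fun y (hy : 2 * A < ‖y‖) => by
      rw [mem_ofPred_eq]; linarith
    have e1 : ∫ y in T, -(c₁ * A ^ (-γ)) * powKernel (2 * s) y
        = ∫ y in {y : EuclideanSpace ℝ (Fin k) | ‖e‖ < ‖y‖},
          T.indicator (fun y => -(c₁ * A ^ (-γ)) * powKernel (2 * s) y) y := by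
      rw [setIntegral_indicator hTm, inter_eq_self_of_subset_right hTA]
    rw [e1]
    refine setIntegral_mono_on hGi
      ((integrable_indicator_iff hTm).2 (hKT.const_mul _)).integrableOn (measurableSet_norm_gt _)
      fun y hy => ?_
    have hy' : ‖e‖ < ‖y‖ := hy
    have hfold := foldedIncrement_bubble_le (β := β) hb hγ.le hρ hy'
    have hK0 := powKernel_nonneg (2 * s) (y - e)
    by_cases hyT : y ∈ T
    · rw [indicator_of_mem hyT]
      have hyA : 2 * A < ‖y‖ := hyT
      have hy0 : 0 < ‖y‖ := by linarith
      have ht : (‖y‖ / ‖e‖) ^ (γ - β) ≤ 2 ^ (γ - β) :=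
        Real.rpow_le_rpow_of_nonpos two_pos ((le_div_iff₀ hρ).2 (by linarith)) (by linarith)
      have hpr : (1 - 2 ^ (-γ)) * A ^ (-γ) * (1 - 2 ^ (γ - β))
          ≤ (bubble b γ ‖e‖ - bubble b γ ‖y‖) * (1 - (‖y‖ / ‖e‖) ^ (γ - β)) :=
        mul_le_mul (hdrop y hyT) (by linarith) (by linarith)
          (le_trans (mul_nonneg (by linarith) hAγ.le) (hdrop y hyT))
      have hb1 := (powKernel_sub_bounds (e := e) (a := 2 * s) (by linarith)
        (norm_pos_iff.1 hy0) (by linarith)).1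
      have m1 := mul_le_mul_of_nonneg_right (hfold.trans (neg_le_neg hpr)) hK0
      have m2 := mul_le_mul_of_nonneg_left hb1
        (mul_nonneg (mul_nonneg (by linarith : (0 : ℝ) ≤ 1 - 2 ^ (-γ)) hAγ.le)
          (by linarith : (0 : ℝ) ≤ 1 - 2 ^ (γ - β)))
      have e2 : -(c₁ * A ^ (-γ)) * powKernel (2 * s) y
          = -((1 - 2 ^ (-γ)) * A ^ (-γ) * (1 - 2 ^ (γ - β)) * ((2 ^ d)⁻¹ * powKernel (2 * s) y)) := by
        rw [hc₁]; ring
      rw [e2]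
      linarith
    · rw [indicator_of_notMem hyT]
      refine mul_nonpos_of_nonpos_of_nonneg (hfold.trans (neg_nonpos.2 (mul_nonneg ?_ ?_))) hK0
      · exact sub_nonneg.2 (bubble_anti hb hγ.le hρ.le hy'.le)
      · exact sub_nonneg.2 (Real.rpow_le_one_of_one_le_of_nonpos
          ((one_le_div hρ).2 hy'.le) (by linarith))

/-- Above the critical exponent a small multiple of `(1 + |x|²)^{-s/(p-1)}` is a supersolution. -/
theorem exists_supersolution (hk : 1 ≤ k) (hs : 1 / 2 < s) (hs1 : s < 1) (hks : 2 * s < k)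
    (hp : (k : ℝ) / ((k : ℝ) - 2 * s) < p) :
    ∃ u : EuclideanSpace ℝ (Fin N) → ℝ, (∀ x, 0 < u x) ∧ IsViscositySupersolution k s p u := by
  set β : ℝ := (k : ℝ) - 2 * s with hβ
  have hβ0 : 0 < β := by linarith
  have hkp : (k : ℝ) < p * β := (div_lt_iff₀ hβ0).1 hp
  have hp1 : 1 < p := by
    by_contra! h
    have := mul_le_mul_of_nonneg_right h hβ0.le
    linarith
  have hp1' : 0 < p - 1 := by linarith
  -- the decay rate is dictated by scaling
  set γ : ℝ := 2 * s / (p - 1) with hγ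
  have hγ0 : 0 < γ := div_pos (by linarith) hp1'
  have hγp : γ * p = γ + 2 * s := by rw [hγ]; field_simp; ring
  have hγβ : γ < β := by
    rw [hγ, div_lt_iff₀ hp1']; nlinarith
  obtain ⟨c, hc, hbub⟩ := exists_symIntegral_bubble_le hk hs hs1 hks.le hγ0 hγβ
  have hn := normConst_pos k (by linarith : 0 < s) hs1
  set ε : ℝ := (normConst k s * c) ^ (1 / (p - 1)) with hε
  have hε0 : 0 < ε := by positivity
  have hεp : ε ^ p = normConst k s * c * ε := by
    have h1 : ε ^ (p - 1) = normConst k s * c := by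
      rw [hε, ← Real.rpow_mul (by positivity), one_div_mul_cancel hp1'.ne', Real.rpow_one]
    rw [← h1, ← Real.rpow_add_one hε0.ne', sub_add_cancel]
  set u : EuclideanSpace ℝ (Fin N) → ℝ := fun y => ε * bubble 1 γ ‖y‖ with hu
  have huc : ContDiff ℝ 2 u := contDiff_const.mul (contDiff_bubble_norm one_pos)
  refine ⟨u, fun x => mul_pos hε0 (Real.rpow_pos_of_pos (by positivity) _),
    huc.continuous.lowerSemicontinuous, fun x δ φ hδ hφ hmin => ?_⟩
  set A : ℝ := Real.sqrt (1 + ‖x‖ ^ 2) with hA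
  have hA0 : 0 < A := Real.sqrt_pos.2 (by positivity)
  have hA2 : A ^ 2 = 1 + ‖x‖ ^ 2 := Real.sq_sqrt (by positivity)
  have hux : u x = ε * A ^ (-γ) := by simp only [hu]; rw [bubble_eq hA0 hA2]
  have huxp : u x ^ p = normConst k s * c * ε * A ^ (-(γ + 2 * s)) := by
    rw [hux, Real.mul_rpow hε0.le (Real.rpow_nonneg hA0.le _), hεp, ← Real.rpow_mul hA0.le,
      neg_mul, hγp]
  have hsup : maxOp k s u φ x δ ≤ ((-(u x ^ p) : ℝ) : EReal) := by
    refine iSup_le fun ξ => ?_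
    obtain ⟨ξ, hξ⟩ := ξ
    obtain ⟨e, a, hea⟩ := exists_norm_sq_add_framePoint hξ x
    have hb : 0 < 1 + a ^ 2 := by positivity
    have hFe : (fun τ => u (x + framePoint ξ τ))
        = fun τ => (fun y : EuclideanSpace ℝ (Fin k) => ε * bubble (1 + a ^ 2) γ ‖y‖) (e + τ) := by
      ext τ
      simp only [hu, bubble]
      rw [hea, add_assoc]
    have hA2' : A ^ 2 = 1 + a ^ 2 + ‖e‖ ^ 2 := by
      have := hea 0
      rw [framePoint_zero, add_zero, add_zero] at this
      rw [hA2, this, add_assoc]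
    have hsym : symIntegral s (fun τ => u (x + framePoint ξ τ)) 0
        = ε * symIntegral s (fun y => bubble (1 + a ^ 2) γ ‖y‖) e := by
      rw [hFe, symIntegral_comp_add s
        (fun y : EuclideanSpace ℝ (Fin k) => ε * bubble (1 + a ^ 2) γ ‖y‖),
        symIntegral_const_mul s ε fun y : EuclideanSpace ℝ (Fin k) => bubble (1 + a ^ 2) γ ‖y‖]
    have hFc : ContDiff ℝ 2 (fun τ => u (x + framePoint ξ τ)) :=
      huc.comp (contDiff_const.add (contDiff_framePoint ξ))
    have hball : ∀ y, y ∈ Metric.ball x δ → φ y - φ x ≤ u y - u x := fun y hy => by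
      have h1 : u x - φ x ≤ u y - φ y := hmin hy
      linarith
    have hle := evaluation_le_symIntegral (u := u) (φ := φ) (x := x) (ξ := ξ) hk hs hs1
      hFc.continuous.measurable (e := 0) (B := ε * 1 ^ (-(γ / 2)))
      (fun τ => by
        rw [abs_mul, abs_of_pos hε0]
        exact mul_le_mul_of_nonneg_left (abs_bubble_le one_pos hγ0.le _) hε0.le)
      hFc.contDiffAt hδ
      (fun τ hτ => by
        have h1 := hball (x + framePoint ξ τ) (by simpa [dist_eq_norm, norm_framePoint hξ] using hτ)
        have h2 := hball (x - framePoint ξ τ) (by simpa [dist_eq_norm, norm_framePoint hξ] using hτ)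
        simp only [symDiff, zero_add, zero_sub, framePoint_neg, framePoint_zero, add_zero,
          ← sub_eq_add_neg]
        linarith)
      (fun τ _ => le_of_eq (by simp [framePoint_zero]))
    refine hle.trans (EReal.coe_le_coe_iff.2 ?_)
    rw [hsym, huxp]
    have h1 := mul_le_mul_of_nonneg_left (hbub (1 + a ^ 2) hb e A hA0 hA2')
      (mul_nonneg hn.le hε0.le)
    linarith
  refine (add_le_add_left hsup _).trans ?_
  rw [← EReal.coe_add, neg_add_cancel, EReal.coe_zero]

end Existence

end TruncFracLap

end

theorem mainTheorem9 (N k : ℕ) (hk : 1 < k) (hkN : k < N) (s : ℝ) (hs : 1 / 2 < s) (hs1 : s < 1)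
    (p : ℝ) :
    (∃ u : EuclideanSpace ℝ (Fin N) → ℝ, (∀ x, 0 ≤ u x) ∧ (∃ x, u x ≠ 0) ∧
        TruncFracLap.IsViscositySupersolution k s p u) ↔
      (k : ℝ) / ((k : ℝ) - 2 * s) < p := by
  have hk2 : (2 : ℝ) ≤ k := by exact_mod_cast hk
  have hks : 2 * s < k := by linarith
  constructor
  · rintro ⟨u, h0, hne, hu⟩
    exact hu.critical_lt hk.le hkN.le hs hs1 hks
      (hu.pos hk.le hkN.le (by linarith) hs1 h0 hne)
  · intro hp
    obtain ⟨u, hpos, hu⟩ := TruncFracLap.exists_supersolution (N := N) hk.le hs hs1 hks hp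
    exact ⟨u, fun x => (hpos x).le, ⟨0, (hpos 0).ne'⟩, hu⟩
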